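/- Consider on the half plane $\{(x_1,x_2):x_1>0\}$ the control system $\dot x_1=x_2$, $\dot x_2=-u x_1+1/x_1^3$, i.e. $\dot x=f(x)+u\,g(x)$ with $f=(x_2,1/x_1^3)$, $g=(0,-x_1)$, where $u$ is Lebesgue measurable with $u_1\le u(t)\le u_2$ for almost every $t$, and the problem of steering $(1,0)$ to $(\gamma,0)$ in minimum time $T$. It is assumed that $\gamma>1$ and $0<u_1\le 1/\gamma^4<1\le u_2<\infty$. Write $X=f+u_1g$, $Y=f+u_2g$; an $X$-segment (resp. $Y$-segment) is a piece of trajectory of positive duration with control $u=u_1$ (resp. $u=u_2$) almost everywhere. Let $H(\lambda_0,\lambda,x,u)=\lambda_0+\langle\lambda,f(x)+u\,g(x)\rangle$. An extremal is a controlled trajectory $(x,u)$ on some $[0,T]$, $T>0$, with $x(0)=(1,0)$, $x(T)=(\gamma,0)$, $x$ absolutely continuous and lying in $\{x_1>0\}$, for which there are a constant $\lambda_0\le 0$ and an absolutely continuous nowhere vanishing $\lambda:[0,T]\to(\mathbb R^2)^*$ such that for almost every $t\in[0,T]$: $\dot\lambda(t)=-\frac{\partial H}{\partial x}(\lambda_0,\lambda(t),x(t),u(t))$;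 the function $v\mapsto H(\lambda_0,\lambda(t),x(t),v)$ attains its maximum over $[u_1,u_2]$ at $v=u(t)$; and $H(\lambda_0,\lambda(t),x(t),u(t))=0$. Suppose $u_2=1$. Then $(1,0)$ is an equilibrium of the $Y$-field; no extremal begins with a $Y$-segment; and every extremal is of the form $XYXY\cdots XY$ with an odd number $2n+1$ of switchings, $n\ge 0$ (an alternating concatenation of $X$- and $Y$-segments beginning with an $X$-segment and ending with a $Y$-segment). Moreover, extremals with more than one switching do occur: for some $\gamma$ and $u_1$ as above, with $u_2=1$, there is an extremal of this form with $2n+1\ge 3$ switchings. -/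

import Mathlib

open MeasureTheory Set

noncomputable section

namespace Oscillator

/-- The standing assumption on the target abscissa `γ` and the control bounds `u₁`, `u₂`. -/
structure Bounds (γ u₁ u₂ : ℝ) : Prop where
  one_lt : 1 < γ
  pos : 0 < u₁
  le_target : u₁ ≤ 1 / γ ^ 4
  target_lt : 1 / γ ^ 4 < 1
  one_le : 1 ≤ u₂

/-- The drift vector field `f = (x₂, 1 / x₁³)`. -/
def drift (x : ℝ × ℝ) : ℝ × ℝ := (x.2, 1 / x.1 ^ 3)

/-- The control vector field `g = (0, -x₁)`. -/
def ctrl (x : ℝ × ℝ) : ℝ × ℝ := (0, -x.1)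

/-- The vector field `f + v g` of the constant control `v`. The `X`-field is `field u₁`, and the
`Y`-field is `field u₂`. -/
def field (v : ℝ) (x : ℝ × ℝ) : ℝ × ℝ := drift x + v • ctrl x

/-- `(x, u)` is a controlled trajectory on `[0, T]`, `T > 0`: the control `u` is Lebesgue measurable
with values in `[u₁, u₂]` almost everywhere, and `x` is an absolutely continuous curve in the half
plane `x₁ > 0` with `x' = f(x) + u g(x)` almost everywhere. -/
structure IsControlledTrajectory (u₁ u₂ T : ℝ) (x : ℝ → ℝ × ℝ) (u : ℝ → ℝ) : Prop where
  T_pos : 0 < T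
  aemeasurable : AEMeasurable u (volume.restrict (Icc 0 T))
  mem_Icc : ∀ᵐ t ∂volume.restrict (Icc 0 T), u t ∈ Icc u₁ u₂
  absCont_fst : AbsolutelyContinuousOnInterval (fun t => (x t).1) 0 T
  absCont_snd : AbsolutelyContinuousOnInterval (fun t => (x t).2) 0 T
  mem_domain : ∀ t ∈ Icc 0 T, 0 < (x t).1
  ode : ∀ᵐ t ∂volume.restrict (Icc 0 T), HasDerivAt x (field (u t) (x t)) t

/-- The control Hamiltonian `λ₀ + ⟨λ, f(x) + v g(x)⟩`. -/
def hamiltonian (l₀ : ℝ) (l x : ℝ × ℝ) (v : ℝ) : ℝ :=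
  l₀ + (l.1 * (field v x).1 + l.2 * (field v x).2)

/-- The right-hand side `-∂H/∂x` of the adjoint equation. -/
def adjointRHS (l₀ : ℝ) (l x : ℝ × ℝ) (v : ℝ) : ℝ × ℝ :=
  (-deriv (fun y => hamiltonian l₀ l (y, x.2) v) x.1,
    -deriv (fun y => hamiltonian l₀ l (x.1, y) v) x.2)

theorem adjointRHS_eq (l₀ : ℝ) (l x : ℝ × ℝ) (v : ℝ) (hx : 0 < x.1) :
    adjointRHS l₀ l x v = (l.2 * (v + 3 / x.1 ^ 4), -l.1) := by
  have h1 : HasDerivAt (fun y : ℝ => hamiltonian l₀ l (y, x.2) v)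
      (-(l.2 * (v + 3 / x.1 ^ 4))) x.1 := by
    have hi : HasDerivAt (fun y : ℝ => 1 / y ^ 3) (-(3 * x.1 ^ 2) / (x.1 ^ 3) ^ 2) x.1 := by
      have h := (hasDerivAt_pow 3 x.1).fun_inv (pow_ne_zero 3 hx.ne')
      simpa [one_div] using h
    have h := (((hi.add ((hasDerivAt_id' x.1).neg.const_mul v)).const_mul l.2).const_add
      (l.1 * x.2)).const_add l₀
    refine (h.congr_deriv ?_).congr_of_eventuallyEq (Filter.Eventually.of_forall fun y => ?_)
    · have := hx.ne'
      field_simp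
      ring
    · simp [hamiltonian, field, drift, ctrl]
  have h2 : HasDerivAt (fun y : ℝ => hamiltonian l₀ l (x.1, y) v) l.1 x.2 := by
    have h := (((hasDerivAt_id' x.2).const_mul l.1).add_const
      (l.2 * (1 / x.1 ^ 3 + v * -x.1))).const_add l₀
    refine (h.congr_deriv (by ring)).congr_of_eventuallyEq
      (Filter.Eventually.of_forall fun y => ?_)
    simp [hamiltonian, field, drift, ctrl]
  simp only [adjointRHS, h1.deriv, h2.deriv, neg_neg]

/-- The multipliers `l₀`, `l` satisfy the conditions of the maximum principle (for minimum time)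
along `(x, u)`. -/
structure IsMultiplier (u₁ u₂ T : ℝ) (x : ℝ → ℝ × ℝ) (u : ℝ → ℝ) (l₀ : ℝ) (l : ℝ → ℝ × ℝ) :
    Prop where
  nonpos : l₀ ≤ 0
  ne_zero : ∀ t ∈ Icc 0 T, l t ≠ 0
  absCont_fst : AbsolutelyContinuousOnInterval (fun t => (l t).1) 0 T
  absCont_snd : AbsolutelyContinuousOnInterval (fun t => (l t).2) 0 T
  adjoint : ∀ᵐ t ∂volume.restrict (Icc 0 T), HasDerivAt l (adjointRHS l₀ (l t) (x t) (u t)) t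
  maximum : ∀ᵐ t ∂volume.restrict (Icc 0 T), ∀ v ∈ Icc u₁ u₂,
    hamiltonian l₀ (l t) (x t) v ≤ hamiltonian l₀ (l t) (x t) (u t)
  zero : ∀ᵐ t ∂volume.restrict (Icc 0 T), hamiltonian l₀ (l t) (x t) (u t) = 0

/-- `(x, u)` is an extremal on `[0, T]` of the minimum-time transfer from `(1, 0)` to `(γ, 0)`. -/
structure IsExtremal (γ u₁ u₂ T : ℝ) (x : ℝ → ℝ × ℝ) (u : ℝ → ℝ) : Prop where
  trajectory : IsControlledTrajectory u₁ u₂ T x u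
  initial : x 0 = (1, 0)
  final : x T = (γ, 0)
  multiplier : ∃ (l₀ : ℝ) (l : ℝ → ℝ × ℝ), IsMultiplier u₁ u₂ T x u l₀ l

/-- The control starts with the constant value `v` on some nontrivial interval; `v = u₂` means that
the trajectory begins with a `Y`-segment. -/
def BeginsWith (v T : ℝ) (u : ℝ → ℝ) : Prop :=
  ∃ τ, 0 < τ ∧ τ ≤ T ∧ ∀ᵐ t ∂volume.restrict (Ioo 0 τ), u t = v

/-- The trajectory of the control `u` on `[0, T]` is an alternating concatenation `XYXY…` of `m + 1`
segments of positive duration, beginning with an `X`-segment, with exactly `m` switchings (at the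
times `τ 1, …, τ m`). For odd `m` it is of the form `XY…XY`. -/
def IsAlternatingFromX (u₁ u₂ T : ℝ) (u : ℝ → ℝ) (m : ℕ) : Prop :=
  ∃ τ : ℕ → ℝ, τ 0 = 0 ∧ τ (m + 1) = T ∧ (∀ j ≤ m, τ j < τ (j + 1)) ∧
    ∀ j ≤ m, ∀ᵐ t ∂volume.restrict (Ioo (τ j) (τ (j + 1))), u t = if Even j then u₁ else u₂

end Oscillator

end

noncomputable section

namespace Oscillator

/-! The Hamiltonian is affine in the control with slope `-l₂ x₁`, so `u = u₁` where `l₂ > 0` and `u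
= 1` where `l₂ < 0`. As `l₂' = -l₁` and the covector never vanishes, the zeros of `l₂` are simple:
there are finitely many, and the control alternates at each interior one. What remains is that the
first arc is an `X`-arc and the last a `Y`-arc.

On an arc of control `c`, `w = l₂ x₁` satisfies `w'' = 2 l₀ - 4 c w` and `p = x₁ x₂` satisfies `p''
= -4 c p`. The first integral of `w` and a Wronskian of the two equations, evaluated at consecutive
zeros of `l₂` together with the energy and `H = 0`, give `IsArc.conjugate`: `x₁(b)² (x₂(a)² + c
x₁(a)²) = 1` and its mirror image. Hence (`step_of_one_le`, `step_of_le_one`) the `X`-energy `x₂² +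
u₁ x₁² + 1/x₁²` stays at least its initial value `u₁ + 1` at all switchings. The target has smaller
`X`-energy (`energy_target_lt`), so the last arc cannot be an `X`-arc. An initial `Y`-arc would rest
at `(1, 0)`, which forces `l₀ = 0`; then `H = 0` at the target forces `l₂ = 0` there, so the last
`Y`-arc also joins two zeros of `l₂` and the energy bound reaches the target, a contradiction.

For the example, the oscillator is solved explicitly (an Ermakov–Pinney equation) and four arcs are
glued, with parameters chosen to make every switching point algebraic. -/

/-! ### Calculus at the ends of an interval. -/

theorem eq_of_hasDerivAt_zero {a b : ℝ} {f f' : ℝ → ℝ} (hab : a < b)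
    (hf : ContinuousOn f (Icc a b)) (hd : ∀ t ∈ Ioo a b, HasDerivAt f (f' t) t)
    (h0 : ∀ t ∈ Ioo a b, f' t = 0) : f b = f a := by
  obtain ⟨c, hc, h⟩ := exists_hasDerivAt_eq_slope f f' hab hf hd
  rw [h0 c hc, eq_comm, div_eq_zero_iff] at h
  rcases h with h | h <;> linarith

/-- A function vanishing at the left end and positive inside has nonnegative slope there. -/
theorem nonneg_deriv_left {a b : ℝ} {g g' : ℝ → ℝ} (hab : a < b) (hg : ContinuousOn g (Icc a b))
    (hg' : ContinuousOn g' (Icc a b)) (hd : ∀ t ∈ Ioo a b, HasDerivAt g (g' t) t)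
    (h0 : g a = 0) (hpos : ∀ t ∈ Ioo a b, 0 < g t) : 0 ≤ g' a := by
  by_contra! hneg
  have hev := (hg' a (left_mem_Icc.2 hab.le)).eventually_lt_const hneg
  obtain ⟨δ, hδ, hsub⟩ := Metric.mem_nhdsWithin_iff.1 hev
  set s := min (a + δ / 2) ((a + b) / 2) with hs
  have h1 : a < s := lt_min (by linarith) (by linarith)
  have h2 : s < b := (min_le_right _ _).trans_lt (by linarith)
  have h3 : s ≤ a + δ / 2 := min_le_left _ _
  obtain ⟨c, hc, hcs⟩ := exists_hasDerivAt_eq_slope g g' h1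
    (hg.mono (Icc_subset_Icc_right h2.le)) fun t ht => hd t ⟨ht.1, ht.2.trans h2⟩
  have hc' : g' c < 0 := by
    refine hsub ⟨?_, hc.1.le, (hc.2.trans h2).le⟩
    rw [Metric.mem_ball, Real.dist_eq, abs_of_pos (by linarith [hc.1])]
    linarith [hc.2]
  have : 0 < (g s - g a) / (s - a) := by
    rw [h0, sub_zero]
    exact div_pos (hpos s ⟨h1, h2⟩) (by linarith)
  linarith

theorem nonpos_deriv_right {a b : ℝ} {g g' : ℝ → ℝ} (hab : a < b) (hg : ContinuousOn g (Icc a b))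
    (hg' : ContinuousOn g' (Icc a b)) (hd : ∀ t ∈ Ioo a b, HasDerivAt g (g' t) t)
    (h0 : g b = 0) (hpos : ∀ t ∈ Ioo a b, 0 < g t) : g' b ≤ 0 := by
  have hm : MapsTo (fun t : ℝ => -t) (Icc (-b) (-a)) (Icc a b) := fun t ht =>
    ⟨by linarith [ht.2], by linarith [ht.1]⟩
  have hm' : ∀ t ∈ Ioo (-b) (-a), -t ∈ Ioo a b := fun t ht =>
    ⟨by linarith [ht.2], by linarith [ht.1]⟩
  have := nonneg_deriv_left (a := -b) (b := -a) (g := fun t => g (-t)) (g' := fun t => -g' (-t))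
    (by linarith) (hg.comp continuous_neg.continuousOn hm)
    (hg'.comp continuous_neg.continuousOn hm).neg
    (fun t ht => ((hd (-t) (hm' t ht)).scomp t (hasDerivAt_neg t)).congr_deriv (by simp))
    (by simpa using h0) (fun t ht => hpos _ (hm' t ht))
  simpa using this

/-! ### Arcs of constant control: conserved quantities and conjugate points. -/

/-- A trajectory, with coordinates `x₁`, `x₂`, and an adjoint curve, with coordinates `l₁`, `l₂`,
of the constant control `c` on `[a, b]`, on the zero level of the Hamiltonian. -/
structure IsArc (c l₀ a b : ℝ) (x₁ x₂ l₁ l₂ : ℝ → ℝ) : Prop where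
  lt : a < b
  cont_x₁ : ContinuousOn x₁ (Icc a b)
  cont_x₂ : ContinuousOn x₂ (Icc a b)
  cont_l₁ : ContinuousOn l₁ (Icc a b)
  cont_l₂ : ContinuousOn l₂ (Icc a b)
  pos : ∀ t ∈ Icc a b, 0 < x₁ t
  deriv_x₁ : ∀ t ∈ Ioo a b, HasDerivAt x₁ (x₂ t) t
  deriv_x₂ : ∀ t ∈ Ioo a b, HasDerivAt x₂ (1 / x₁ t ^ 3 - c * x₁ t) t
  deriv_l₁ : ∀ t ∈ Ioo a b, HasDerivAt l₁ (l₂ t * (c + 3 / x₁ t ^ 4)) t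
  deriv_l₂ : ∀ t ∈ Ioo a b, HasDerivAt l₂ (-l₁ t) t
  ham : ∀ t ∈ Icc a b, l₀ + (l₁ t * x₂ t + l₂ t * (1 / x₁ t ^ 3 - c * x₁ t)) = 0

/-- Twice the energy of the oscillator with constant control `c`. -/
def energy (c x y : ℝ) : ℝ := y ^ 2 + c * x ^ 2 + 1 / x ^ 2

namespace IsArc

variable {c l₀ a b : ℝ} {x₁ x₂ l₁ l₂ : ℝ → ℝ}

/-- The adjoint system and `H = 0` are linear in `(l₀, l)`, and no sign of `l₀` is part of an arc.
This reduces arcs with `l₂ < 0` to arcs with `l₂ > 0`. -/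
theorem neg (h : IsArc c l₀ a b x₁ x₂ l₁ l₂) :
    IsArc c (-l₀) a b x₁ x₂ (fun t => -l₁ t) (fun t => -l₂ t) where
  lt := h.lt
  cont_x₁ := h.cont_x₁
  cont_x₂ := h.cont_x₂
  cont_l₁ := h.cont_l₁.neg
  cont_l₂ := h.cont_l₂.neg
  pos := h.pos
  deriv_x₁ := h.deriv_x₁
  deriv_x₂ := h.deriv_x₂
  deriv_l₁ t ht := (h.deriv_l₁ t ht).fun_neg.congr_deriv (by ring)
  deriv_l₂ t ht := (h.deriv_l₂ t ht).fun_neg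
  ham t ht := by linear_combination -h.ham t ht

theorem hasDerivAt_one_div_sq (h : IsArc c l₀ a b x₁ x₂ l₁ l₂) {t : ℝ} (ht : t ∈ Ioo a b) :
    HasDerivAt (fun t => 1 / x₁ t ^ 2) (-2 * x₂ t / x₁ t ^ 3) t := by
  have hx := (h.pos t (Ioo_subset_Icc_self ht)).ne'
  simp only [one_div]
  refine (((h.deriv_x₁ t ht).fun_pow 2).fun_inv (pow_ne_zero 2 hx)).congr_deriv ?_
  push_cast
  field_simp

theorem energy_eq (h : IsArc c l₀ a b x₁ x₂ l₁ l₂) :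
    energy c (x₁ b) (x₂ b) = energy c (x₁ a) (x₂ a) := by
  refine eq_of_hasDerivAt_zero (f := fun t => energy c (x₁ t) (x₂ t)) h.lt ?_
    (fun t ht => (((h.deriv_x₂ t ht).fun_pow 2).add (((h.deriv_x₁ t ht).fun_pow 2).const_mul c)).add
      (h.hasDerivAt_one_div_sq ht)) ?_
  · have hx := h.cont_x₁
    have hy := h.cont_x₂
    have : ∀ t ∈ Icc a b, x₁ t ^ 2 ≠ 0 := fun t ht => pow_ne_zero 2 (h.pos t ht).ne'
    unfold energy
    fun_prop (disch := assumption)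
  · intro t ht
    have := (h.pos t (Ioo_subset_Icc_self ht)).ne'
    field_simp
    ring

/-- Eliminating `l₁ x₂` through `H = 0` cancels the `1 / x₁³` terms, so `w = l₂ x₁` obeys a linear
equation with constant coefficients, decoupled from the state. -/
theorem hasDerivAt_moment (h : IsArc c l₀ a b x₁ x₂ l₁ l₂) {t : ℝ} (ht : t ∈ Ioo a b) :
    HasDerivAt (fun t => l₂ t * x₂ t - l₁ t * x₁ t) (2 * l₀ - 4 * c * (l₂ t * x₁ t)) t := by
  refine (((h.deriv_l₂ t ht).fun_mul (h.deriv_x₂ t ht)).fun_sub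
    ((h.deriv_l₁ t ht).fun_mul (h.deriv_x₁ t ht))).congr_deriv ?_
  have hH := h.ham t (Ioo_subset_Icc_self ht)
  have := (h.pos t (Ioo_subset_Icc_self ht)).ne'
  have h4 : 3 / x₁ t ^ 4 * x₁ t = 3 * (1 / x₁ t ^ 3) := by field_simp
  linear_combination (-2) * hH - l₂ t * h4

theorem hasDerivAt_switching (h : IsArc c l₀ a b x₁ x₂ l₁ l₂) {t : ℝ} (ht : t ∈ Ioo a b) :
    HasDerivAt (fun t => l₂ t * x₁ t) (l₂ t * x₂ t - l₁ t * x₁ t) t :=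
  ((h.deriv_l₂ t ht).fun_mul (h.deriv_x₁ t ht)).congr_deriv (by ring)

theorem cont_moment (h : IsArc c l₀ a b x₁ x₂ l₁ l₂) :
    ContinuousOn (fun t => l₂ t * x₂ t - l₁ t * x₁ t) (Icc a b) :=
  (h.cont_l₂.mul h.cont_x₂).sub (h.cont_l₁.mul h.cont_x₁)

/-- First integral `w'² + 4 c w² - 4 l₀ w` of the equation for `w = l₂ x₁`; at a zero of `l₂` only
`w'² = (l₁ x₁)²` survives. -/
theorem moment_sq_eq (h : IsArc c l₀ a b x₁ x₂ l₁ l₂) (ha : l₂ a = 0) (hb : l₂ b = 0) :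
    (l₁ b * x₁ b) ^ 2 = (l₁ a * x₁ a) ^ 2 := by
  have key := eq_of_hasDerivAt_zero (f := fun t => (l₂ t * x₂ t - l₁ t * x₁ t) ^ 2 +
      4 * c * (l₂ t * x₁ t) ^ 2 - 4 * l₀ * (l₂ t * x₁ t)) h.lt
    (((h.cont_moment.pow 2).add (((h.cont_l₂.mul h.cont_x₁).pow 2).const_mul (4 * c))).sub
      ((h.cont_l₂.mul h.cont_x₁).const_mul (4 * l₀)))
    (fun t ht => (((h.hasDerivAt_moment ht).fun_pow 2).fun_add
      (((h.hasDerivAt_switching ht).fun_pow 2).const_mul (4 * c))).fun_sub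
      ((h.hasDerivAt_switching ht).const_mul (4 * l₀)))
    (fun t ht => by ring)
  simp only [ha, hb] at key
  linear_combination key

/-- The slope `-l₁` of `l₂` is nonnegative where `l₂` leaves zero and nonpositive where it returns,
which selects the sign of the square root. -/
theorem moment_eq_neg (h : IsArc c l₀ a b x₁ x₂ l₁ l₂) (ha : l₂ a = 0) (hb : l₂ b = 0)
    (hpos : ∀ t ∈ Ioo a b, 0 < l₂ t) : l₁ b * x₁ b = -(l₁ a * x₁ a) := by
  have h1 := nonneg_deriv_left h.lt h.cont_l₂ h.cont_l₁.neg h.deriv_l₂ ha hpos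
  have h2 := nonpos_deriv_right h.lt h.cont_l₂ h.cont_l₁.neg h.deriv_l₂ hb hpos
  have h3 := h.pos a (left_mem_Icc.2 h.lt.le)
  have h4 := h.pos b (right_mem_Icc.2 h.lt.le)
  simp only [Pi.neg_apply] at h1 h2
  rcases sq_eq_sq_iff_eq_or_eq_neg.1 (h.moment_sq_eq ha hb) with h5 | h5
  · have h6 : 0 ≤ l₁ b * x₁ b := mul_nonneg (by linarith) h4.le
    have h7 : l₁ a * x₁ a ≤ 0 := mul_nonpos_of_nonpos_of_nonneg (by linarith) h3.le
    linarith
  · exact h5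

/-- With `p = x₁ x₂` and `q = c x₁² - x₂² - 1/x₁²` one has `p' = -q` and `q' = 4 c p`. The conserved
quantity is the Wronskian of `p` and `w - l₀ / (2c)`, up to a constant factor, in a form free of
division by `c`. -/
theorem wronskian_eq (h : IsArc c l₀ a b x₁ x₂ l₁ l₂) (ha : l₂ a = 0) (hb : l₂ b = 0) :
    (c * x₁ b ^ 2 - x₂ b ^ 2 - 1 / x₁ b ^ 2) * (l₁ b * x₁ b) - 2 * (x₁ b * x₂ b) * l₀ =
      (c * x₁ a ^ 2 - x₂ a ^ 2 - 1 / x₁ a ^ 2) * (l₁ a * x₁ a) - 2 * (x₁ a * x₂ a) * l₀ := by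
  have hne : ∀ t ∈ Icc a b, x₁ t ^ 2 ≠ 0 := fun t ht => pow_ne_zero 2 (h.pos t ht).ne'
  have key := eq_of_hasDerivAt_zero (f := fun t => (c * x₁ t ^ 2 - x₂ t ^ 2 - 1 / x₁ t ^ 2) *
      (l₂ t * x₂ t - l₁ t * x₁ t) - 2 * (x₁ t * x₂ t) * (2 * c * (l₂ t * x₁ t) - l₀)) h.lt
    (by
      have h1 := h.cont_x₁
      have h2 := h.cont_x₂
      have h3 := h.cont_l₁
      have h4 := h.cont_l₂
      fun_prop (disch := assumption))
    (fun t ht => (((((h.deriv_x₁ t ht).fun_pow 2).const_mul c).fun_sub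
      ((h.deriv_x₂ t ht).fun_pow 2)).fun_sub
      (h.hasDerivAt_one_div_sq ht)).fun_mul
      (h.hasDerivAt_moment ht) |>.fun_sub
      ((((h.deriv_x₁ t ht).fun_mul (h.deriv_x₂ t ht)).const_mul 2).fun_mul
        (((h.hasDerivAt_switching ht).const_mul (2 * c)).sub_const l₀)))
    (fun t ht => by
      have := (h.pos t (Ioo_subset_Icc_self ht)).ne'
      field_simp
      ring)
  simp only [ha, hb] at key
  linear_combination -key

/-- The relation between the end points of an arc between two consecutive zeros of `l₂`. -/
theorem conjugate (h : IsArc c l₀ a b x₁ x₂ l₁ l₂) (ha : l₂ a = 0) (hb : l₂ b = 0)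
    (hla : l₁ a ≠ 0) (hsign : (∀ t ∈ Ioo a b, 0 < l₂ t) ∨ ∀ t ∈ Ioo a b, l₂ t < 0) :
    x₁ b ^ 2 * (x₂ a ^ 2 + c * x₁ a ^ 2) = 1 ∧ x₁ a ^ 2 * (x₂ b ^ 2 + c * x₁ b ^ 2) = 1 := by
  have hneg : l₁ b * x₁ b = -(l₁ a * x₁ a) := by
    rcases hsign with hs | hs
    · exact h.moment_eq_neg ha hb hs
    · have := h.neg.moment_eq_neg (by simpa using ha) (by simpa using hb)
        (fun t ht => by simpa using hs t ht)
      linear_combination -this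
  have hxa := h.pos a (left_mem_Icc.2 h.lt.le)
  have hxb := h.pos b (right_mem_Icc.2 h.lt.le)
  have hHa := h.ham a (left_mem_Icc.2 h.lt.le)
  have hHb := h.ham b (right_mem_Icc.2 h.lt.le)
  have hE := h.energy_eq
  have hW := h.wronskian_eq ha hb
  rw [ha] at hHa
  rw [hb] at hHb
  unfold energy at hE
  -- At a zero of `l₂`, `H = 0` reads `l₀ = -l₁ x₂`. This removes `l₀` from the Wronskian identity,
  -- and `l₁ x₁`, which only changes sign, factors out. The energy then supplies the second linear
  -- relation.
  have hS : x₂ b ^ 2 + c * x₁ b ^ 2 - 1 / x₁ b ^ 2 =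
      -(x₂ a ^ 2 + c * x₁ a ^ 2 - 1 / x₁ a ^ 2) := by
    have : l₁ a * x₁ a * (x₂ b ^ 2 + c * x₁ b ^ 2 - 1 / x₁ b ^ 2 +
        (x₂ a ^ 2 + c * x₁ a ^ 2 - 1 / x₁ a ^ 2)) = 0 := by
      linear_combination -hW + 2 * x₁ a * x₂ a * hHa - 2 * x₁ b * x₂ b * hHb +
        (x₂ b ^ 2 + c * x₁ b ^ 2 - 1 / x₁ b ^ 2) * hneg
    rcases mul_eq_zero.1 this with h0 | h0
    · exact absurd h0 (mul_ne_zero hla hxa.ne')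
    · linarith
  have e1 : x₁ b ^ 2 * (1 / x₁ b ^ 2) = 1 := by field_simp
  have e2 : x₁ a ^ 2 * (1 / x₁ a ^ 2) = 1 := by field_simp
  constructor
  · linear_combination e1 - x₁ b ^ 2 / 2 * hE + x₁ b ^ 2 / 2 * hS
  · linear_combination e2 + x₁ a ^ 2 / 2 * hE + x₁ a ^ 2 / 2 * hS

end IsArc

/-! ### Regularity from almost everywhere data, simple zeros, partitions. -/

/-- An absolutely continuous function whose derivative agrees almost everywhere with a continuous
function is continuously differentiable. -/
theorem hasDerivAt_of_ae {f h : ℝ → ℝ} {a b : ℝ} (hf : AbsolutelyContinuousOnInterval f a b)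
    (hh : ContinuousOn h (Icc a b)) (hd : ∀ᵐ t, t ∈ Ioo a b → HasDerivAt f (h t) t) :
    ∀ t ∈ Ioo a b, HasDerivAt f (h t) t := by
  intro t ht
  have hab : a ≤ b := (ht.1.trans ht.2).le
  have hint : ∀ s ∈ Icc a b, f s = f a + ∫ r in a..s, h r := by
    intro s hs
    have hs' : AbsolutelyContinuousOnInterval f a s :=
      hf.mono (by rw [uIcc_of_le hs.1, uIcc_of_le hab]; exact Icc_subset_Icc_right hs.2)
    have : ∫ r in a..s, deriv f r = ∫ r in a..s, h r := by
      refine intervalIntegral.integral_congr_ae ?_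
      have hb : ∀ᵐ r : ℝ, r ≠ b := by simp [ae_iff]
      filter_upwards [hd, hb] with r hr hrb hrs
      rw [uIoc_of_le hs.1] at hrs
      exact (hr ⟨hrs.1, lt_of_le_of_ne (hrs.2.trans hs.2) hrb⟩).deriv
    rw [← this, hs'.integral_deriv_eq_sub]
    ring
  have hc : ContinuousAt h t := hh.continuousAt (Icc_mem_nhds ht.1 ht.2)
  have hii : IntervalIntegrable h volume a t :=
    (hh.mono (by rw [uIcc_of_le ht.1.le]; exact Icc_subset_Icc_right ht.2.le)).intervalIntegrable
  have hm : StronglyMeasurableAtFilter h (nhds t) volume :=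
    ⟨Icc a b, Icc_mem_nhds ht.1 ht.2, hh.aestronglyMeasurable measurableSet_Icc⟩
  refine ((intervalIntegral.integral_hasDerivAt_right hii hm hc).const_add (f a)).congr_of_eventuallyEq
    ?_
  filter_upwards [Icc_mem_nhds ht.1 ht.2] with s hs using hint s hs

/-- A continuously differentiable function on `[a, b]` without critical zeros has finitely many
zeros. -/
theorem finite_zeros {f f' : ℝ → ℝ} {a b : ℝ} (hf : ContinuousOn f (Icc a b))
    (hf' : ContinuousOn f' (Icc a b)) (hd : ∀ t ∈ Ioo a b, HasDerivAt f (f' t) t)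
    (hne : ∀ t ∈ Icc a b, f t = 0 → f' t ≠ 0) : {t ∈ Icc a b | f t = 0}.Finite := by
  by_contra hinf
  obtain ⟨t, ht, hacc⟩ := Set.Infinite.exists_accPt_of_subset_isCompact hinf
    (isCompact_Icc (a := a) (b := b)) (fun s hs => hs.1)
  rw [accPt_iff_frequently] at hacc
  have ht0 : f t = 0 := by
    by_contra h0
    have hev := (hf t ht).eventually_ne h0
    rw [eventually_nhdsWithin_iff] at hev
    obtain ⟨s, hs, hs'⟩ := (hacc.and_eventually hev).exists
    exact hs' hs.2.1 hs.2.2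
  have hev := (hf' t ht).eventually_ne (hne t ht ht0)
  rw [eventually_nhdsWithin_iff] at hev
  obtain ⟨δ, hδ, hball⟩ := Metric.eventually_nhds_iff.1 hev
  obtain ⟨s, ⟨hst, hs⟩, hsδ⟩ := (hacc.and_eventually (Metric.ball_mem_nhds t hδ)).exists
  rw [Real.dist_eq, abs_lt] at hsδ
  -- Rolle between `t` and a nearby zero gives a zero of `f'` inside the ball where `f'` does not
  -- vanish.
  have aux : ∀ p q, p ∈ Icc a b → q ∈ Icc a b → p < q → f p = 0 → f q = 0 → ∃ c ∈ Ioo p q,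
      f' c = 0 := fun p q hp hq hpq h1 h2 =>
    exists_hasDerivAt_eq_zero hpq (hf.mono (Icc_subset_Icc hp.1 hq.2)) (h1.trans h2.symm)
      fun c hc => hd c ⟨hp.1.trans_lt hc.1, hc.2.trans_le hq.2⟩
  rcases lt_or_gt_of_ne hst with h | h
  · obtain ⟨c, hc, hc0⟩ := aux s t hs.1 ht h hs.2 ht0
    refine hball ?_ ⟨hs.1.1.trans hc.1.le, hc.2.le.trans ht.2⟩ hc0
    rw [Real.dist_eq, abs_lt]
    constructor <;> linarith [hc.1, hc.2]
  · obtain ⟨c, hc, hc0⟩ := aux t s ht hs.1 h ht0 hs.2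
    refine hball ?_ ⟨ht.1.trans hc.1.le, hc.2.le.trans hs.1.2⟩ hc0
    rw [Real.dist_eq, abs_lt]
    constructor <;> linarith [hc.1, hc.2]

theorem pos_or_neg_of_ne_zero {f : ℝ → ℝ} {a b : ℝ} (hf : ContinuousOn f (Ioo a b))
    (hne : ∀ t ∈ Ioo a b, f t ≠ 0) : (∀ t ∈ Ioo a b, 0 < f t) ∨ ∀ t ∈ Ioo a b, f t < 0 := by
  by_contra! h
  obtain ⟨⟨s, hs, hs0⟩, t, ht, ht0⟩ := h
  obtain ⟨r, hr, hr0⟩ := (isPreconnected_Ioo.image f hf).ordConnected.out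
    (mem_image_of_mem f hs) (mem_image_of_mem f ht) ⟨hs0, ht0⟩
  exact hne r hr hr0

/-- A function does not keep its sign across a simple zero. -/
theorem not_pos_of_pos {f : ℝ → ℝ} {a b c d : ℝ} (hab : a < b) (hbc : b < c)
    (hd : HasDerivAt f d b) (hne : d ≠ 0) (h0 : f b = 0) (h1 : ∀ t ∈ Ioo a b, 0 < f t) :
    ¬ ∀ t ∈ Ioo b c, 0 < f t := by
  intro h2
  refine hne (IsLocalMin.hasDerivAt_eq_zero ?_ hd)
  filter_upwards [Ioo_mem_nhds hab hbc] with t ht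
  rw [h0]
  rcases lt_trichotomy t b with h | h | h
  · exact (h1 t ⟨ht.1, h⟩).le
  · rw [h, h0]
  · exact (h2 t ⟨h, ht.2⟩).le

theorem not_neg_of_neg {f : ℝ → ℝ} {a b c d : ℝ} (hab : a < b) (hbc : b < c)
    (hd : HasDerivAt f d b) (hne : d ≠ 0) (h0 : f b = 0) (h1 : ∀ t ∈ Ioo a b, f t < 0) :
    ¬ ∀ t ∈ Ioo b c, f t < 0 := fun h2 =>
  not_pos_of_pos hab hbc hd.fun_neg (neg_ne_zero.2 hne) (by simp [h0])
    (fun t ht => neg_pos.2 (h1 t ht)) fun t ht => neg_pos.2 (h2 t ht)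

/-- Finitely many points of an interval, together with its end points, in increasing order. -/
theorem exists_partition {a b : ℝ} (hab : a < b) (Z : Set ℝ) (hZ : Z.Finite)
    (hsub : Z ⊆ Icc a b) : ∃ (N : ℕ) (τ : ℕ → ℝ), τ 0 = a ∧ τ (N + 1) = b ∧
      (∀ j ≤ N, τ j < τ (j + 1)) ∧ (∀ j ≤ N + 1, τ j ∈ Icc a b) ∧
      (∀ j, 1 ≤ j → j ≤ N → τ j ∈ Z) ∧ ∀ j ≤ N, ∀ t ∈ Ioo (τ j) (τ (j + 1)), t ∉ Z := by
  classical
  set S : Finset ℝ := insert a (insert b hZ.toFinset) with hS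
  have hmem : ∀ t, t ∈ S ↔ t = a ∨ t = b ∨ t ∈ Z := fun t => by simp [hS]
  have hSI : ∀ t ∈ S, t ∈ Icc a b := by
    intro t ht
    rcases (hmem t).1 ht with rfl | rfl | h
    · exact left_mem_Icc.2 hab.le
    · exact right_mem_Icc.2 hab.le
    · exact hsub h
  have h2 : 1 < S.card := Finset.one_lt_card.2
    ⟨a, (hmem a).2 (Or.inl rfl), b, (hmem b).2 (Or.inr (Or.inl rfl)), hab.ne⟩
  -- `N` counts the points of `Z` strictly inside: zeros of `l₂` at `0` or `T` are not switchings.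
  obtain ⟨N, hN⟩ : ∃ N, S.card = N + 2 := ⟨S.card - 2, by omega⟩
  set e := S.orderEmbOfFin hN with he
  have hrange : ∀ t ∈ S, ∃ i, e i = t := by
    intro t ht
    have : t ∈ Set.range e := by rw [he, Finset.range_orderEmbOfFin]; exact ht
    exact this
  have heS : ∀ i, e i ∈ S := fun i => Finset.orderEmbOfFin_mem S hN i
  have h0 : e 0 = a := by
    obtain ⟨i, hi⟩ := hrange a ((hmem a).2 (Or.inl rfl))
    refine le_antisymm ?_ (hSI _ (heS 0)).1
    rw [← hi]
    exact e.monotone (Fin.zero_le i)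
  have hlast : e (Fin.last _) = b := by
    obtain ⟨i, hi⟩ := hrange b ((hmem b).2 (Or.inr (Or.inl rfl)))
    refine le_antisymm (hSI _ (heS _)).2 ?_
    rw [← hi]
    exact e.monotone (Fin.le_last i)
  refine ⟨N, fun j => if h : j < N + 2 then e ⟨j, h⟩ else 0, ?_, ?_, ?_, ?_, ?_, ?_⟩
  · simpa using h0
  · simpa [Fin.last] using hlast
  · intro j hj
    beta_reduce
    rw [dif_pos (by omega), dif_pos (by omega)]
    exact e.strictMono (by simp [Fin.lt_def])
  · intro j hj
    beta_reduce
    rw [dif_pos (by omega)]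
    exact hSI _ (heS _)
  · intro j h1 hj
    beta_reduce
    rw [dif_pos (by omega)]
    rcases (hmem _).1 (heS ⟨j, by omega⟩) with h | h | h
    · rw [← h0] at h
      have := congrArg Fin.val (e.injective h)
      simp at this
      omega
    · rw [← hlast] at h
      have := congrArg Fin.val (e.injective h)
      simp at this
      omega
    · exact h
  · intro j hj t ht htZ
    beta_reduce at ht
    rw [dif_pos (by omega), dif_pos (by omega)] at ht
    obtain ⟨i, rfl⟩ := hrange t ((hmem t).2 (Or.inr (Or.inr htZ)))
    have h1 := e.lt_iff_lt.1 ht.1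
    have h2 := e.lt_iff_lt.1 ht.2
    simp only [Fin.lt_def] at h1 h2
    omega

/-! ### Consequences of the maximum principle. -/

section Extremal

variable {u₁ u₂ T l₀ a b c : ℝ} {x : ℝ → ℝ × ℝ} {u : ℝ → ℝ} {l : ℝ → ℝ × ℝ}

theorem hamiltonian_eq (l₀ : ℝ) (p y : ℝ × ℝ) (v : ℝ) :
    hamiltonian l₀ p y v = l₀ + (p.1 * y.2 + p.2 * (1 / y.1 ^ 3 - v * y.1)) := by
  simp only [hamiltonian, field, drift, ctrl, Prod.fst_add, Prod.snd_add, Prod.smul_mk, smul_eq_mul]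
  ring

theorem IsMultiplier.continuousOn_fst (hm : IsMultiplier u₁ u₂ T x u l₀ l) (hT : 0 < T) :
    ContinuousOn (fun t => (l t).1) (Icc 0 T) := by
  simpa [uIcc_of_le hT.le] using hm.absCont_fst.continuousOn

theorem IsMultiplier.continuousOn_snd (hm : IsMultiplier u₁ u₂ T x u l₀ l) (hT : 0 < T) :
    ContinuousOn (fun t => (l t).2) (Icc 0 T) := by
  simpa [uIcc_of_le hT.le] using hm.absCont_snd.continuousOn

theorem IsMultiplier.ae_hasDerivAt (hx : IsControlledTrajectory u₁ u₂ T x u)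
    (hm : IsMultiplier u₁ u₂ T x u l₀ l) : ∀ᵐ t, t ∈ Icc 0 T →
      HasDerivAt (fun t => (l t).1) ((l t).2 * (u t + 3 / (x t).1 ^ 4)) t ∧
      HasDerivAt (fun t => (l t).2) (-(l t).1) t := by
  filter_upwards [(ae_restrict_iff' measurableSet_Icc).1 hm.adjoint] with t ht hT
  have h := ht hT
  rw [adjointRHS_eq _ _ _ _ (hx.mem_domain t hT)] at h
  exact ⟨(hasFDerivAt_fst.comp_hasDerivAt t h :), (hasFDerivAt_snd.comp_hasDerivAt t h :)⟩

theorem IsControlledTrajectory.ae_hasDerivAt (hx : IsControlledTrajectory u₁ u₂ T x u) :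
    ∀ᵐ t, t ∈ Icc 0 T → HasDerivAt (fun t => (x t).1) (x t).2 t ∧
      HasDerivAt (fun t => (x t).2) (1 / (x t).1 ^ 3 - u t * (x t).1) t := by
  filter_upwards [(ae_restrict_iff' measurableSet_Icc).1 hx.ode] with t ht hT
  have h := ht hT
  refine ⟨(hasFDerivAt_fst.comp_hasDerivAt t h).congr_deriv ?_,
    (hasFDerivAt_snd.comp_hasDerivAt t h).congr_deriv ?_⟩
  · simp [field, drift, ctrl]
  · simp [field, drift, ctrl, sub_eq_add_neg]

/-- Where the control is constant, an extremal and its multiplier form an arc. -/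
theorem IsMultiplier.isArc (hx : IsControlledTrajectory u₁ u₂ T x u)
    (hm : IsMultiplier u₁ u₂ T x u l₀ l) (ha : 0 ≤ a) (hab : a < b) (hb : b ≤ T)
    (hu : ∀ᵐ t ∂volume.restrict (Ioo a b), u t = c) :
    IsArc c l₀ a b (fun t => (x t).1) (fun t => (x t).2) (fun t => (l t).1)
      (fun t => (l t).2) := by
  have hI : Icc a b ⊆ Icc 0 T := Icc_subset_Icc ha hb
  have hu' := (ae_restrict_iff' measurableSet_Ioo).1 hu
  have hmono : ∀ {f : ℝ → ℝ}, AbsolutelyContinuousOnInterval f 0 T →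
      AbsolutelyContinuousOnInterval f a b := fun hf =>
    hf.mono (by rwa [uIcc_of_le hab.le, uIcc_of_le (ha.trans (hab.le.trans hb))])
  have hcont : ∀ {f : ℝ → ℝ}, AbsolutelyContinuousOnInterval f 0 T →
      ContinuousOn f (Icc a b) := fun hf => by
    simpa [uIcc_of_le hab.le] using (hmono hf).continuousOn
  have c1 := hcont hx.absCont_fst
  have c2 := hcont hx.absCont_snd
  have c3 := hcont hm.absCont_fst
  have c4 := hcont hm.absCont_snd
  have hpos : ∀ t ∈ Icc a b, 0 < (x t).1 := fun t ht => hx.mem_domain t (hI ht)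
  have h3 : ∀ t ∈ Icc a b, (x t).1 ^ 3 ≠ 0 := fun t ht => pow_ne_zero 3 (hpos t ht).ne'
  have h4 : ∀ t ∈ Icc a b, (x t).1 ^ 4 ≠ 0 := fun t ht => pow_ne_zero 4 (hpos t ht).ne'
  have dx := hx.ae_hasDerivAt
  have dl := hm.ae_hasDerivAt hx
  refine ⟨hab, c1, c2, c3, c4, hpos, hasDerivAt_of_ae (hmono hx.absCont_fst) c2 ?_,
    hasDerivAt_of_ae (hmono hx.absCont_snd) ?_ ?_, hasDerivAt_of_ae (hmono hm.absCont_fst) ?_ ?_,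
    hasDerivAt_of_ae (hmono hm.absCont_snd) c3.neg ?_, ?_⟩
  · filter_upwards [dx] with t h1 ht using (h1 (hI (Ioo_subset_Icc_self ht))).1
  · fun_prop (disch := assumption)
  · filter_upwards [dx, hu'] with t h1 h2 ht
    rw [← h2 ht]
    exact (h1 (hI (Ioo_subset_Icc_self ht))).2
  · fun_prop (disch := assumption)
  · filter_upwards [dl, hu'] with t h1 h2 ht
    rw [← h2 ht]
    exact (h1 (hI (Ioo_subset_Icc_self ht))).1
  · filter_upwards [dl] with t h1 ht using (h1 (hI (Ioo_subset_Icc_self ht))).2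
  -- Continuity upgrades `H = 0` to every point of the closed interval, end points included; the
  -- arguments at switchings and at the target need it there.
  · refine Measure.eqOn_Icc_of_ae_eq volume hab.ne ?_ ?_ continuousOn_const
    · rw [← restrict_Ioo_eq_restrict_Icc]
      refine (ae_restrict_iff' measurableSet_Ioo).2 ?_
      filter_upwards [(ae_restrict_iff' measurableSet_Icc).1 hm.zero, hu'] with t h1 h2 ht
      have := h1 (hI (Ioo_subset_Icc_self ht))
      rwa [hamiltonian_eq, h2 ht] at this
    · fun_prop (disch := assumption)

/-- The Hamiltonian decreases in the control, since its slope there is `-l₂ x₁ < 0`. -/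
theorem IsMultiplier.eq_lower (hx : IsControlledTrajectory u₁ u₂ T x u) (hle : u₁ ≤ u₂)
    (hm : IsMultiplier u₁ u₂ T x u l₀ l) (ha : 0 ≤ a) (hb : b ≤ T)
    (hpos : ∀ t ∈ Ioo a b, 0 < (l t).2) : ∀ᵐ t ∂volume.restrict (Ioo a b), u t = u₁ := by
  refine (ae_restrict_iff' measurableSet_Ioo).2 ?_
  filter_upwards [(ae_restrict_iff' measurableSet_Icc).1 hm.maximum,
    (ae_restrict_iff' measurableSet_Icc).1 hx.mem_Icc] with t h1 h2 ht
  have hI : t ∈ Icc 0 T := ⟨ha.trans ht.1.le, ht.2.le.trans hb⟩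
  have h := h1 hI u₁ (left_mem_Icc.2 hle)
  rw [hamiltonian_eq, hamiltonian_eq] at h
  have hp := mul_pos (hpos t ht) (hx.mem_domain t hI)
  refine le_antisymm ?_ (h2 hI).1
  by_contra! hlt
  nlinarith [mul_lt_mul_of_pos_right hlt hp]

theorem IsMultiplier.eq_upper (hx : IsControlledTrajectory u₁ u₂ T x u) (hle : u₁ ≤ u₂)
    (hm : IsMultiplier u₁ u₂ T x u l₀ l) (ha : 0 ≤ a) (hb : b ≤ T)
    (hneg : ∀ t ∈ Ioo a b, (l t).2 < 0) : ∀ᵐ t ∂volume.restrict (Ioo a b), u t = u₂ := by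
  refine (ae_restrict_iff' measurableSet_Ioo).2 ?_
  filter_upwards [(ae_restrict_iff' measurableSet_Icc).1 hm.maximum,
    (ae_restrict_iff' measurableSet_Icc).1 hx.mem_Icc] with t h1 h2 ht
  have hI : t ∈ Icc 0 T := ⟨ha.trans ht.1.le, ht.2.le.trans hb⟩
  have h := h1 hI u₂ (right_mem_Icc.2 hle)
  rw [hamiltonian_eq, hamiltonian_eq] at h
  have hp := mul_pos (neg_pos.2 (hneg t ht)) (hx.mem_domain t hI)
  refine le_antisymm (h2 hI).2 ?_
  by_contra! hlt
  nlinarith [mul_lt_mul_of_pos_right hlt hp]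

end Extremal

/-! ### Energy estimates and their propagation from switching to switching. -/

theorem energy_sub (c d x y : ℝ) : energy c x y - energy d x y = (c - d) * x ^ 2 := by
  unfold energy
  ring

/-- The difference factors as `(γ² - 1)(u₁ γ² - 1) / γ²`, and `u₁ γ⁴ ≤ 1` with `γ > 1` gives `u₁ γ²
< 1`. -/
theorem energy_target_lt {γ u₁ u₂ : ℝ} (h : Bounds γ u₁ u₂) : energy u₁ γ 0 < u₁ + 1 := by
  have hγ := h.one_lt
  have h2 : 1 < γ ^ 2 := one_lt_pow₀ hγ two_ne_zero
  have h3 : u₁ * γ ^ 4 ≤ 1 := (le_div_iff₀ (by positivity)).1 h.le_target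
  have h4 : energy u₁ γ 0 - (u₁ + 1) = (γ ^ 2 - 1) * (u₁ * γ ^ 2 - 1) / γ ^ 2 := by
    unfold energy
    field_simp
    ring
  have h5 : u₁ * γ ^ 2 < 1 := by nlinarith [mul_pos h.pos (by positivity : 0 < γ ^ 2)]
  have : (γ ^ 2 - 1) * (u₁ * γ ^ 2 - 1) / γ ^ 2 < 0 :=
    div_neg_of_neg_of_pos (mul_neg_of_pos_of_neg (by linarith) (by linarith)) (by positivity)
  linarith

theorem one_le_of_energy_eq {c x y : ℝ} (hc : c < 1) (hx : 0 < x)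
    (h : energy c x y = c + 1) : 1 ≤ x := by
  by_contra! hlt
  have h1 : x ^ 2 < 1 := pow_lt_one₀ hx.le hlt two_ne_zero
  have h0 : 0 < x ^ 2 := by positivity
  have h2 : energy c x y - (c + 1) = y ^ 2 + (1 - x ^ 2) * (1 - c * x ^ 2) / x ^ 2 := by
    unfold energy
    field_simp
    ring
  have h3 : c * x ^ 2 < 1 := by nlinarith
  have : 0 < (1 - x ^ 2) * (1 - c * x ^ 2) / x ^ 2 :=
    div_pos (mul_pos (by linarith) (by linarith)) h0
  nlinarith [sq_nonneg y]

theorem eq_equilibrium_of_energy_eq {x y : ℝ} (hx : 0 < x) (h : energy 1 x y = 2) :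
    x = 1 ∧ y = 0 := by
  have h2 : energy 1 x y - 2 = y ^ 2 + (x - 1 / x) ^ 2 := by
    unfold energy
    field_simp
    ring
  have h3 : y ^ 2 = 0 := by nlinarith [sq_nonneg y, sq_nonneg (x - 1 / x)]
  have h4 : (x - 1 / x) ^ 2 = 0 := by nlinarith [sq_nonneg y, sq_nonneg (x - 1 / x)]
  have h5 : x = 1 / x := by linarith [pow_eq_zero_iff two_ne_zero |>.1 h4]
  rw [eq_div_iff hx.ne'] at h5
  exact ⟨by nlinarith, pow_eq_zero_iff two_ne_zero |>.1 h3⟩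

namespace IsArc

variable {c l₀ a b u₁ : ℝ} {x₁ x₂ l₁ l₂ : ℝ → ℝ}

/-- The conjugacy relation `x₁(a)² (x₂(b)² + x₁(b)²) = 1` puts the end point in the unit disc. As
the `Y`-energy is conserved, the `X`-energy changes by `(1 - u₁)(x₁(a)² - x₁(b)²) ≥ 0`. -/
theorem step_of_one_le (h : IsArc 1 l₀ a b x₁ x₂ l₁ l₂) (ha : l₂ a = 0) (hb : l₂ b = 0)
    (hla : l₁ a ≠ 0) (hsign : (∀ t ∈ Ioo a b, 0 < l₂ t) ∨ ∀ t ∈ Ioo a b, l₂ t < 0)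
    (hu : u₁ ≤ 1) (hx : 1 ≤ x₁ a) (he : u₁ + 1 ≤ energy u₁ (x₁ a) (x₂ a)) :
    x₁ b ^ 2 + x₂ b ^ 2 ≤ 1 ∧ u₁ + 1 ≤ energy u₁ (x₁ b) (x₂ b) := by
  obtain ⟨-, h2⟩ := h.conjugate ha hb hla hsign
  have h3 : 1 ≤ x₁ a ^ 2 := one_le_pow₀ hx
  have h4 : x₁ b ^ 2 + x₂ b ^ 2 ≤ 1 := by nlinarith [sq_nonneg (x₁ b), sq_nonneg (x₂ b)]
  refine ⟨h4, ?_⟩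
  have h5 := h.energy_eq
  have h6 := energy_sub 1 u₁ (x₁ a) (x₂ a)
  have h7 := energy_sub 1 u₁ (x₁ b) (x₂ b)
  nlinarith [sq_nonneg (x₂ b)]

/-- Here the other conjugacy relation is used: `x₁(b)² (x₂(a)² + u₁ x₁(a)²) = 1` with bracket at
most `1`. The `X`-energy is conserved. -/
theorem step_of_le_one (h : IsArc u₁ l₀ a b x₁ x₂ l₁ l₂) (ha : l₂ a = 0) (hb : l₂ b = 0)
    (hla : l₁ a ≠ 0) (hsign : (∀ t ∈ Ioo a b, 0 < l₂ t) ∨ ∀ t ∈ Ioo a b, l₂ t < 0)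
    (hu : u₁ ≤ 1) (hx : x₁ a ^ 2 + x₂ a ^ 2 ≤ 1) (he : u₁ + 1 ≤ energy u₁ (x₁ a) (x₂ a)) :
    1 ≤ x₁ b ∧ u₁ + 1 ≤ energy u₁ (x₁ b) (x₂ b) := by
  obtain ⟨h2, -⟩ := h.conjugate ha hb hla hsign
  have hxb := h.pos b (right_mem_Icc.2 h.lt.le)
  have h3 : x₂ a ^ 2 + u₁ * x₁ a ^ 2 ≤ 1 := by nlinarith [sq_nonneg (x₁ a)]
  refine ⟨?_, he.trans_eq h.energy_eq.symm⟩
  by_contra! hlt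
  have : x₁ b ^ 2 < 1 := pow_lt_one₀ hxb.le hlt two_ne_zero
  nlinarith [sq_nonneg (x₁ b)]

end IsArc

/-! ### The switching structure of extremals. -/

/-- Along an extremal with `u₂ = 1`, the switching times split `[0, T]` into arcs on which the sign
of `l₂` alternates, the last of them being a `Y`-arc and the first an `X`-arc. -/
theorem IsExtremal.exists_isAlternatingFromX {γ u₁ T : ℝ} {x : ℝ → ℝ × ℝ} {u : ℝ → ℝ}
    (hB : Bounds γ u₁ 1) (hE : IsExtremal γ u₁ 1 T x u) :
    ∃ n : ℕ, IsAlternatingFromX u₁ 1 T u (2 * n + 1) := by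
  obtain ⟨hx, hx0, hxT, l₀, l, hm⟩ := hE
  have hT := hx.T_pos
  have hu1 : u₁ < 1 := hB.le_target.trans_lt hB.target_lt
  have c1 := hm.continuousOn_fst hT
  have c2 := hm.continuousOn_snd hT
  have hsimple : ∀ t ∈ Icc 0 T, (l t).2 = 0 → (l t).1 ≠ 0 := fun t ht h2 h1 =>
    hm.ne_zero t ht (Prod.ext h1 h2)
  have hd : ∀ t ∈ Ioo 0 T, HasDerivAt (fun t => (l t).2) (-(l t).1) t :=
    hasDerivAt_of_ae hm.absCont_snd c1.neg (by
      filter_upwards [hm.ae_hasDerivAt hx] with t h ht using (h (Ioo_subset_Icc_self ht)).2)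
  obtain ⟨N, τ, hτ0, hτT, hlt, hmem, hz, hnz⟩ := exists_partition hT
    {t ∈ Icc 0 T | (l t).2 = 0}
    (finite_zeros c2 c1.neg hd fun t ht h => neg_ne_zero.2 (hsimple t ht h)) (sep_subset _ _)
  have hzero : ∀ j, 1 ≤ j → j ≤ N → (l (τ j)).2 = 0 := fun j h1 h2 => (hz j h1 h2).2
  have hsub : ∀ j ≤ N, Icc (τ j) (τ (j + 1)) ⊆ Icc 0 T := fun j hj =>
    Icc_subset_Icc (hmem j (by omega)).1 (hmem (j + 1) (by omega)).2
  have hsign : ∀ j ≤ N, (∀ t ∈ Ioo (τ j) (τ (j + 1)), 0 < (l t).2) ∨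
      ∀ t ∈ Ioo (τ j) (τ (j + 1)), (l t).2 < 0 := fun j hj =>
    pos_or_neg_of_ne_zero (c2.mono (Ioo_subset_Icc_self.trans (hsub j hj))) fun t ht h =>
      hnz j hj t ht ⟨hsub j hj (Ioo_subset_Icc_self ht), h⟩
  have hX : ∀ j ≤ N, (∀ t ∈ Ioo (τ j) (τ (j + 1)), 0 < (l t).2) →
      ∀ᵐ t ∂volume.restrict (Ioo (τ j) (τ (j + 1))), u t = u₁ := fun j hj h =>
    hm.eq_lower hx hu1.le (hmem j (by omega)).1 (hmem (j + 1) (by omega)).2 h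
  have hY : ∀ j ≤ N, (∀ t ∈ Ioo (τ j) (τ (j + 1)), (l t).2 < 0) →
      ∀ᵐ t ∂volume.restrict (Ioo (τ j) (τ (j + 1))), u t = 1 := fun j hj h =>
    hm.eq_upper hx hu1.le (hmem j (by omega)).1 (hmem (j + 1) (by omega)).2 h
  have arc : ∀ j ≤ N, ∀ c, (∀ᵐ t ∂volume.restrict (Ioo (τ j) (τ (j + 1))), u t = c) →
      IsArc c l₀ (τ j) (τ (j + 1)) (fun t => (x t).1) (fun t => (x t).2) (fun t => (l t).1)
        (fun t => (l t).2) := fun j hj c hc =>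
    hm.isArc hx (hmem j (by omega)).1 (hlt j hj) (hmem (j + 1) (by omega)).2 hc
  have hint : ∀ j, 1 ≤ j → j ≤ N → τ j ∈ Ioo 0 T := by
    intro j h1 hj
    obtain ⟨i, rfl⟩ : ∃ i, j = i + 1 := ⟨j - 1, by omega⟩
    exact ⟨(hmem i (by omega)).1.trans_lt (hlt i (by omega)),
      (hlt (i + 1) hj).trans_le (hmem (i + 2) (by omega)).2⟩
  have altX : ∀ j, j + 1 ≤ N → (∀ t ∈ Ioo (τ j) (τ (j + 1)), 0 < (l t).2) →
      ∀ t ∈ Ioo (τ (j + 1)) (τ (j + 1 + 1)), (l t).2 < 0 := fun j hj h =>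
    (hsign (j + 1) hj).resolve_left (not_pos_of_pos (hlt j (by omega)) (hlt (j + 1) hj)
      (hd _ (hint (j + 1) (by omega) hj))
      (neg_ne_zero.2 (hsimple _ (hmem _ (by omega)) (hzero _ (by omega) hj)))
      (hzero _ (by omega) hj) h)
  have altY : ∀ j, j + 1 ≤ N → (∀ t ∈ Ioo (τ j) (τ (j + 1)), (l t).2 < 0) →
      ∀ t ∈ Ioo (τ (j + 1)) (τ (j + 1 + 1)), 0 < (l t).2 := fun j hj h =>
    (hsign (j + 1) hj).resolve_right (not_neg_of_neg (hlt j (by omega)) (hlt (j + 1) hj)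
      (hd _ (hint (j + 1) (by omega) hj))
      (neg_ne_zero.2 (hsimple _ (hmem _ (by omega)) (hzero _ (by omega) hj)))
      (hzero _ (by omega) hj) h)
  have contra : ∀ a b : ℝ, a < b → (∀ t ∈ Ioo a b, 0 < (l t).2) →
      (∀ t ∈ Ioo a b, (l t).2 < 0) → False := fun a b hab h1 h2 => by
    have hmid : (a + b) / 2 ∈ Ioo a b := ⟨by linarith, by linarith⟩
    exact lt_asymm (h1 _ hmid) (h2 _ hmid)
  have htarget := energy_target_lt hB
  -- The equilibrium is the only point of its `Y`-energy level, and the drift plus control vanishes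
  -- there, so `H = 0` reduces to `l₀ = 0`.
  have stay : (∀ t ∈ Ioo (τ 0) (τ (0 + 1)), (l t).2 < 0) → l₀ = 0 ∧ x (τ 1) = (1, 0) := by
    intro h
    have harc := arc 0 (by omega) 1 (hY 0 (by omega) h)
    have h1 := harc.energy_eq
    have h2 := harc.ham (τ 0) (left_mem_Icc.2 harc.lt.le)
    simp only [hτ0, hx0] at h1 h2
    obtain ⟨h3, h4⟩ := eq_equilibrium_of_energy_eq
      (harc.pos (τ 1) (right_mem_Icc.2 harc.lt.le)) (h1.trans (by norm_num [energy]))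
    exact ⟨by simpa using h2, Prod.ext h3 h4⟩
  -- The induction starts at the first switching, because `IsArc.conjugate` needs `l₂ = 0` at both
  -- ends and nothing is known of `l₂` at time `0`.
  have inv : ∀ j, 1 ≤ j → j ≤ N → u₁ + 1 ≤ energy u₁ (x (τ j)).1 (x (τ j)).2 ∧
      ((∀ t ∈ Ioo (τ j) (τ (j + 1)), 0 < (l t).2) → (x (τ j)).1 ^ 2 + (x (τ j)).2 ^ 2 ≤ 1) ∧
      ((∀ t ∈ Ioo (τ j) (τ (j + 1)), (l t).2 < 0) → 1 ≤ (x (τ j)).1) := by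
    intro j h1
    induction j, h1 using Nat.le_induction with
    | base =>
      intro hN
      rcases hsign 0 (by omega) with h | h
      · have harc := arc 0 (by omega) u₁ (hX 0 (by omega) h)
        have he := harc.energy_eq
        simp only [hτ0, hx0] at he
        have he' : energy u₁ (x (τ 1)).1 (x (τ 1)).2 = u₁ + 1 := he.trans (by norm_num [energy])
        refine ⟨he'.ge, fun h' => (contra _ _ (hlt 1 hN) h' (altX 0 hN h)).elim,
          fun _ => one_le_of_energy_eq hu1 (hx.mem_domain _ (hmem 1 (by omega))) he'⟩
      · obtain ⟨-, hs⟩ := stay h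
        rw [hs]
        norm_num [energy]
    | succ j h1 ih =>
      intro hN
      obtain ⟨he, i1, i2⟩ := ih (by omega)
      have hl := hsimple _ (hmem j (by omega)) (hzero j h1 (by omega))
      rcases hsign j (by omega) with h | h
      · obtain ⟨s1, s2⟩ := (arc j (by omega) u₁ (hX j (by omega) h)).step_of_le_one
          (hzero j h1 (by omega)) (hzero (j + 1) (by omega) hN) hl (Or.inl h) hu1.le (i1 h) he
        exact ⟨s2, fun h' => (contra _ _ (hlt (j + 1) hN) h'
          (altX j hN h)).elim, fun _ => s1⟩
      · obtain ⟨s1, s2⟩ := (arc j (by omega) 1 (hY j (by omega) h)).step_of_one_le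
          (hzero j h1 (by omega)) (hzero (j + 1) (by omega) hN) hl (Or.inr h) hu1.le (i2 h) he
        exact ⟨s2, fun _ => s1, fun h' => (contra _ _ (hlt (j + 1) hN)
          (altY j hN h) h').elim⟩
  have last : ∀ t ∈ Ioo (τ N) (τ (N + 1)), (l t).2 < 0 := by
    refine (hsign N le_rfl).resolve_left fun h => ?_
    have harc := arc N le_rfl u₁ (hX N le_rfl h)
    have he := harc.energy_eq
    simp only [hτT, hxT] at he
    rcases Nat.eq_zero_or_pos N with hN | hN
    · rw [hN, hτ0, hx0] at he
      norm_num [energy] at he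
      norm_num [energy] at htarget
      linarith
    · have := (inv N hN le_rfl).1
      linarith
  have first : ∀ t ∈ Ioo (τ 0) (τ (0 + 1)), 0 < (l t).2 := by
    refine (hsign 0 (by omega)).resolve_right fun h => ?_
    obtain ⟨hl0, hs⟩ := stay h
    have hγ := hB.one_lt
    rcases Nat.eq_zero_or_pos N with hN | hN
    · rw [hN] at hτT
      rw [hτT, hxT] at hs
      have := congrArg Prod.fst hs
      simp only at this
      linarith
    · have harc := arc N le_rfl 1 (hY N le_rfl last)
      have hH := harc.ham (τ (N + 1)) (right_mem_Icc.2 harc.lt.le)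
      simp only [hτT, hxT, hl0, mul_zero, zero_add, mul_eq_zero] at hH
      -- With `l₀ = 0` and `x₂ = 0`, `H = 0` at the target is `l₂ (1/γ³ - γ) = 0`. The final time is
      -- thus a zero of `l₂`, and the step for `Y`-arcs applies to the last arc.
      have hlT : (l (τ (N + 1))).2 = 0 := by
        rw [hτT]
        refine hH.resolve_right fun h0 => ?_
        have : 1 / γ ^ 3 < 1 := by
          rw [div_lt_one (by positivity)]
          exact one_lt_pow₀ hγ three_ne_zero
        linarith
      obtain ⟨he, -, i2⟩ := inv N hN le_rfl
      have := (harc.step_of_one_le (hzero N hN le_rfl) hlT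
        (hsimple _ (hmem N (by omega)) (hzero N hN le_rfl)) (Or.inr last) hu1.le (i2 last) he).2
      simp only [hτT, hxT] at this
      linarith
  have alt : ∀ j ≤ N, (Even j → ∀ t ∈ Ioo (τ j) (τ (j + 1)), 0 < (l t).2) ∧
      (¬ Even j → ∀ t ∈ Ioo (τ j) (τ (j + 1)), (l t).2 < 0) := by
    intro j
    induction j with
    | zero => exact fun _ => ⟨fun _ => first, fun h => absurd Even.zero h⟩
    | succ j ih =>
      intro hj
      obtain ⟨i1, i2⟩ := ih (by omega)
      rw [Nat.even_add_one]
      exact ⟨fun h => altY j hj (i2 h), fun h => altX j hj (i1 (not_not.1 h))⟩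
  have hodd : ¬ Even N := fun hev =>
    contra _ _ (hlt N le_rfl) ((alt N le_rfl).1 hev) last
  obtain ⟨n, rfl⟩ := Nat.not_even_iff_odd.1 hodd
  refine ⟨n, τ, hτ0, hτT, hlt, fun j hj => ?_⟩
  split_ifs with hev
  · exact hX j hj ((alt j hj).1 hev)
  · exact hY j hj ((alt j hj).2 hev)

theorem IsAlternatingFromX.not_beginsWith {u₁ u₂ T : ℝ} {u : ℝ → ℝ} {m : ℕ} (hu : u₁ ≠ u₂)
    (h : IsAlternatingFromX u₁ u₂ T u m) : ¬ BeginsWith u₂ T u := by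
  rintro ⟨s, hs, -, hs'⟩
  obtain ⟨τ, h0, -, hlt, hτ⟩ := h
  have h1 := hτ 0 (Nat.zero_le m)
  have hpos := hlt 0 (Nat.zero_le m)
  rw [h0] at h1 hpos
  rw [if_pos Even.zero, ae_restrict_iff' measurableSet_Ioo] at h1
  rw [ae_restrict_iff' measurableSet_Ioo] at hs'
  have hnull : volume (Ioo 0 (min (τ (0 + 1)) s)) = 0 := by
    refine measure_mono_null ?_ (ae_iff.1 (h1.and hs'))
    intro t ht hcon
    exact hu ((hcon.1 ⟨ht.1, ht.2.trans_le (min_le_left _ _)⟩).symm.trans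
      (hcon.2 ⟨ht.1, ht.2.trans_le (min_le_right _ _)⟩))
  rw [Real.volume_Ioo, ENNReal.ofReal_eq_zero] at hnull
  have := lt_min hpos hs
  linarith

/-! ### Gluing pieces of extremals. -/

/-- The function equal to `f` before `τ` and to `g` from `τ` on. -/
def glue {E : Type*} (τ : ℝ) (f g : ℝ → E) (t : ℝ) : E := if t < τ then f t else g t

section Glue

variable {E : Type*} {τ t : ℝ} {f g : ℝ → E}

theorem glue_of_lt (h : t < τ) : glue τ f g t = f t := if_pos h

theorem glue_of_ge (h : τ ≤ t) : glue τ f g t = g t := if_neg h.not_gt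

theorem glue_eventuallyEq_left (h : t < τ) : glue τ f g =ᶠ[nhds t] f := by
  filter_upwards [Iio_mem_nhds h] with s hs using glue_of_lt hs

theorem glue_eventuallyEq_right (h : τ < t) : glue τ f g =ᶠ[nhds t] g := by
  filter_upwards [Ioi_mem_nhds h] with s hs using glue_of_ge hs.le

theorem glue_forall {p : E → Prop} (hf : ∀ t, p (f t)) (hg : ∀ t, p (g t)) (t : ℝ) :
    p (glue τ f g t) := by
  rcases lt_or_ge t τ with h | h
  · rw [glue_of_lt h]
    exact hf t
  · rw [glue_of_ge h]
    exact hg t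

theorem locallyLipschitz_glue {f g : ℝ → ℝ} (hf : LocallyLipschitz f) (hg : LocallyLipschitz g)
    (h : f τ = g τ) : LocallyLipschitz (glue τ f g) := by
  have : glue τ f g = fun t => f (min t τ) + (g (max t τ) - f τ) := by
    funext t
    rcases lt_or_ge t τ with ht | ht
    · rw [glue_of_lt ht, min_eq_left ht.le, max_eq_right ht.le, h]
      ring
    · rw [glue_of_ge ht, min_eq_right ht, max_eq_left ht]
      ring
  rw [this]
  exact (hf.comp (LocallyLipschitz.id.min_const τ)).add
    ((hg.comp (LocallyLipschitz.id.max_const τ)).sub (LocallyLipschitz.const _))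

end Glue

theorem LocallyLipschitz.absolutelyContinuousOnInterval {f : ℝ → ℝ} (hf : LocallyLipschitz f)
    (a b : ℝ) : AbsolutelyContinuousOnInterval f a b := by
  obtain ⟨K, hK⟩ := (hf.locallyLipschitzOn (s := uIcc a b)).exists_lipschitzOnWith_of_compact
    isCompact_uIcc
  exact hK.absolutelyContinuousOnInterval

/-- A piecewise smooth piece, on `[a, b]`, of a controlled trajectory with its multiplier. -/
structure IsPiece (u₁ u₂ l₀ a b : ℝ) (x : ℝ → ℝ × ℝ) (u : ℝ → ℝ) (l : ℝ → ℝ × ℝ) : Prop where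
  measurable : Measurable u
  mem : ∀ t, u t ∈ Icc u₁ u₂
  pos : ∀ t, 0 < (x t).1
  ne_zero : ∀ t, l t ≠ 0
  lip_x₁ : LocallyLipschitz fun t => (x t).1
  lip_x₂ : LocallyLipschitz fun t => (x t).2
  lip_l₁ : LocallyLipschitz fun t => (l t).1
  lip_l₂ : LocallyLipschitz fun t => (l t).2
  regular : ∃ F : Set ℝ, F.Finite ∧ ∀ t ∈ Icc a b, t ∉ F →
    HasDerivAt x (field (u t) (x t)) t ∧ HasDerivAt l (adjointRHS l₀ (l t) (x t) (u t)) t ∧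
    (∀ v ∈ Icc u₁ u₂, hamiltonian l₀ (l t) (x t) v ≤ hamiltonian l₀ (l t) (x t) (u t)) ∧
    hamiltonian l₀ (l t) (x t) (u t) = 0

theorem IsPiece.glue {u₁ u₂ l₀ a b c : ℝ} {x x' : ℝ → ℝ × ℝ} {u u' : ℝ → ℝ} {l l' : ℝ → ℝ × ℝ}
    (h : IsPiece u₁ u₂ l₀ a b x u l) (h' : IsPiece u₁ u₂ l₀ b c x' u' l') (hx : x b = x' b)
    (hl : l b = l' b) :
    IsPiece u₁ u₂ l₀ a c (glue b x x') (glue b u u') (glue b l l') := by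
  have fst_glue : ∀ f g : ℝ → ℝ × ℝ, (fun t => (Oscillator.glue b f g t).1) =
      Oscillator.glue b (fun t => (f t).1) fun t => (g t).1 := fun f g =>
    funext fun t => apply_ite Prod.fst _ _ _
  have snd_glue : ∀ f g : ℝ → ℝ × ℝ, (fun t => (Oscillator.glue b f g t).2) =
      Oscillator.glue b (fun t => (f t).2) fun t => (g t).2 := fun f g =>
    funext fun t => apply_ite Prod.snd _ _ _
  refine ⟨Measurable.ite measurableSet_Iio h.measurable h'.measurable, glue_forall h.mem h'.mem,
    glue_forall (p := fun y : ℝ × ℝ => 0 < y.1) h.pos h'.pos,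
    glue_forall (p := fun y : ℝ × ℝ => y ≠ 0) h.ne_zero h'.ne_zero, ?_, ?_, ?_, ?_, ?_⟩
  · rw [fst_glue]
    exact locallyLipschitz_glue h.lip_x₁ h'.lip_x₁ (congrArg Prod.fst hx)
  · rw [snd_glue]
    exact locallyLipschitz_glue h.lip_x₂ h'.lip_x₂ (congrArg Prod.snd hx)
  · rw [fst_glue]
    exact locallyLipschitz_glue h.lip_l₁ h'.lip_l₁ (congrArg Prod.fst hl)
  · rw [snd_glue]
    exact locallyLipschitz_glue h.lip_l₂ h'.lip_l₂ (congrArg Prod.snd hl)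
  · obtain ⟨F, hF, hreg⟩ := h.regular
    obtain ⟨F', hF', hreg'⟩ := h'.regular
    refine ⟨insert b (F ∪ F'), (hF.union hF').insert b, fun t ht htF => ?_⟩
    simp only [mem_insert_iff, mem_union, not_or] at htF
    rcases lt_or_gt_of_ne htF.1 with hlt | hlt
    · obtain ⟨h1, h2, h3, h4⟩ := hreg t ⟨ht.1, hlt.le⟩ htF.2.1
      rw [glue_of_lt hlt, glue_of_lt hlt, glue_of_lt hlt]
      exact ⟨h1.congr_of_eventuallyEq (glue_eventuallyEq_left hlt),
        h2.congr_of_eventuallyEq (glue_eventuallyEq_left hlt), h3, h4⟩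
    · obtain ⟨h1, h2, h3, h4⟩ := hreg' t ⟨hlt.le, ht.2⟩ htF.2.2
      rw [glue_of_ge hlt.le, glue_of_ge hlt.le, glue_of_ge hlt.le]
      exact ⟨h1.congr_of_eventuallyEq (glue_eventuallyEq_right hlt),
        h2.congr_of_eventuallyEq (glue_eventuallyEq_right hlt), h3, h4⟩

theorem IsPiece.isExtremal {γ u₁ u₂ l₀ T : ℝ} {x : ℝ → ℝ × ℝ} {u : ℝ → ℝ} {l : ℝ → ℝ × ℝ}
    (h : IsPiece u₁ u₂ l₀ 0 T x u l) (hT : 0 < T) (hl₀ : l₀ ≤ 0) (h0 : x 0 = (1, 0))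
    (h1 : x T = (γ, 0)) : IsExtremal γ u₁ u₂ T x u := by
  obtain ⟨F, hF, hreg⟩ := h.regular
  have hae : ∀ᵐ t ∂volume.restrict (Icc 0 T), t ∈ Icc 0 T ∧ t ∉ F :=
    (ae_restrict_iff' measurableSet_Icc).2 (by
      filter_upwards [compl_mem_ae_iff.2 (hF.measure_zero volume)] with t ht hI using ⟨hI, ht⟩)
  refine ⟨⟨hT, h.measurable.aemeasurable, Filter.Eventually.of_forall h.mem,
    LocallyLipschitz.absolutelyContinuousOnInterval h.lip_x₁ 0 T,
    LocallyLipschitz.absolutelyContinuousOnInterval h.lip_x₂ 0 T, fun t _ => h.pos t, ?_⟩,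
    h0, h1, l₀, l, hl₀, fun t _ => h.ne_zero t,
    LocallyLipschitz.absolutelyContinuousOnInterval h.lip_l₁ 0 T,
    LocallyLipschitz.absolutelyContinuousOnInterval h.lip_l₂ 0 T, ?_, ?_, ?_⟩
  · filter_upwards [hae] with t ht using (hreg t ht.1 ht.2).1
  · filter_upwards [hae] with t ht using (hreg t ht.1 ht.2).2.1
  · filter_upwards [hae] with t ht using (hreg t ht.1 ht.2).2.2.1
  · filter_upwards [hae] with t ht using (hreg t ht.1 ht.2).2.2.2

/-! ### Explicit arcs and multipliers. -/

section CanonicalArc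

/-- `x₁²` along the arc of the control `ω²` that passes at time `0` through the point with
`x₁² = R` and `x₂ = k x₁`. -/
def rad (ω R k s : ℝ) : ℝ :=
  R * (Real.cos (ω * s) + k * (Real.sin (ω * s) / ω)) ^ 2 + (Real.sin (ω * s) / ω) ^ 2 / R

/-- `x₁ x₂` along the same arc. -/
def mom (ω R k s : ℝ) : ℝ :=
  R * (Real.cos (ω * s) + k * (Real.sin (ω * s) / ω)) *
    (k * Real.cos (ω * s) - ω ^ 2 * (Real.sin (ω * s) / ω)) +
    (Real.sin (ω * s) / ω) * Real.cos (ω * s) / R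

/-- `l₂ x₁` along the same arc, for the multiplier with `l₂ = 0` and `l₁ x₁ = 1` at time `0`. -/
def switching (ω k s : ℝ) : ℝ :=
  -(Real.sin (ω * s) / ω * (Real.cos (ω * s) + k * (Real.sin (ω * s) / ω)))

/-- The derivative of `switching`. -/
def switchingDeriv (ω k s : ℝ) : ℝ :=
  -(Real.cos (ω * s) * (Real.cos (ω * s) + k * (Real.sin (ω * s) / ω)) +
    Real.sin (ω * s) / ω * (k * Real.cos (ω * s) - ω ^ 2 * (Real.sin (ω * s) / ω)))

/-- The point with `x₁² = r` and `x₁ x₂ = ρ`. -/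
def stateOf (r ρ : ℝ) : ℝ × ℝ := (√r, ρ / √r)

/-- The covector at `stateOf r ρ` with `l₂ x₁ = w` and `l₂ x₂ - l₁ x₁ = v`. -/
def costateOf (r ρ w v : ℝ) : ℝ × ℝ := ((w * ρ / r - v) / √r, w / √r)

variable {ω R k : ℝ}

theorem hasDerivAt_cos_mul (ω s : ℝ) (hω : ω ≠ 0) :
    HasDerivAt (fun s => Real.cos (ω * s)) (-(ω ^ 2 * (Real.sin (ω * s) / ω))) s := by
  refine ((hasDerivAt_id' s).const_mul ω).cos.congr_deriv ?_
  field_simp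

theorem hasDerivAt_sin_mul_div (ω s : ℝ) (hω : ω ≠ 0) :
    HasDerivAt (fun s => Real.sin (ω * s) / ω) (Real.cos (ω * s)) s := by
  refine (((hasDerivAt_id' s).const_mul ω).sin.div_const ω).congr_deriv ?_
  field_simp

theorem cos_sq_add (ω s : ℝ) (hω : ω ≠ 0) :
    Real.cos (ω * s) ^ 2 + ω ^ 2 * (Real.sin (ω * s) / ω) ^ 2 = 1 := by
  rw [div_pow, mul_div_cancel₀ _ (pow_ne_zero 2 hω), Real.cos_sq_add_sin_sq]

theorem rad_pos (hω : ω ≠ 0) (hR : 0 < R) (s : ℝ) : 0 < rad ω R k s := by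
  unfold rad
  by_cases hS : Real.sin (ω * s) / ω = 0
  · have h := cos_sq_add ω s hω
    rw [hS] at h ⊢
    have : 0 < Real.cos (ω * s) ^ 2 := by nlinarith
    simp only [mul_zero, add_zero]
    positivity
  · positivity

theorem hasDerivAt_rad (hω : ω ≠ 0) (s : ℝ) :
    HasDerivAt (rad ω R k) (2 * mom ω R k s) s := by
  have hC := hasDerivAt_cos_mul ω s hω
  have hS := hasDerivAt_sin_mul_div ω s hω
  refine ((((hC.fun_add (hS.const_mul k)).fun_pow 2).const_mul R).fun_add
    ((hS.fun_pow 2).div_const R)).congr_deriv ?_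
  unfold mom
  push_cast
  ring

/-- Write `rad = y₁² + y₂²` with `y₁ = √R (C + k S)`, `y₂ = S / √R`, two solutions of `y'' = -ω² y`
with Wronskian `1`. This is Lagrange's identity `W² + (y₁ y₁' + y₂ y₂')² = (y₁² + y₂²)(y₁'² +
y₂'²)`. -/
theorem mom_sq (hω : ω ≠ 0) (hR : R ≠ 0) (s : ℝ) :
    1 + mom ω R k s ^ 2 = rad ω R k s *
      (R * (k * Real.cos (ω * s) - ω ^ 2 * (Real.sin (ω * s) / ω)) ^ 2 +
        Real.cos (ω * s) ^ 2 / R) := by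
  have h := cos_sq_add ω s hω
  unfold mom rad
  generalize Real.sin (ω * s) / ω = S at *
  generalize Real.cos (ω * s) = C at *
  field_simp
  linear_combination (-(C ^ 2 + ω ^ 2 * S ^ 2) - 1) * R ^ 2 * h

theorem hasDerivAt_mom (hω : ω ≠ 0) (hR : 0 < R) (s : ℝ) :
    HasDerivAt (mom ω R k)
      ((1 + mom ω R k s ^ 2) / rad ω R k s - ω ^ 2 * rad ω R k s) s := by
  have hC := hasDerivAt_cos_mul ω s hω
  have hS := hasDerivAt_sin_mul_div ω s hω
  refine ((((hC.fun_add (hS.const_mul k)).const_mul R).fun_mul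
    ((hC.const_mul k).fun_sub (hS.const_mul (ω ^ 2)))).fun_add
    ((hS.fun_mul hC).div_const R)).congr_deriv ?_
  rw [mom_sq hω hR.ne', mul_div_cancel_left₀ _ (rad_pos hω hR s).ne']
  unfold rad
  ring

theorem hasDerivAt_switching (hω : ω ≠ 0) (s : ℝ) :
    HasDerivAt (switching ω k) (switchingDeriv ω k s) s := by
  have hC := hasDerivAt_cos_mul ω s hω
  have hS := hasDerivAt_sin_mul_div ω s hω
  refine (hS.fun_mul (hC.fun_add (hS.const_mul k))).fun_neg.congr_deriv ?_
  unfold switchingDeriv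
  ring

theorem hasDerivAt_switchingDeriv (hω : ω ≠ 0) (s : ℝ) :
    HasDerivAt (switchingDeriv ω k) (-2 * k - 4 * ω ^ 2 * switching ω k s) s := by
  have hC := hasDerivAt_cos_mul ω s hω
  have hS := hasDerivAt_sin_mul_div ω s hω
  refine ((hC.fun_mul (hC.fun_add (hS.const_mul k))).fun_add
    (hS.fun_mul ((hC.const_mul k).fun_sub (hS.const_mul (ω ^ 2))))).fun_neg.congr_deriv ?_
  unfold switching
  have h := cos_sq_add ω s hω
  linear_combination (-2 * k) * h

/-- The Hamiltonian vanishes along the arc. -/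
theorem switching_relation (hω : ω ≠ 0) (hR : 0 < R) (s : ℝ) :
    -k * rad ω R k s ^ 2 = switchingDeriv ω k s * mom ω R k s * rad ω R k s +
      ω ^ 2 * switching ω k s * rad ω R k s ^ 2 - switching ω k s * (1 + mom ω R k s ^ 2) := by
  have h := cos_sq_add ω s hω
  rw [mom_sq hω hR.ne']
  have : -k * rad ω R k s = switchingDeriv ω k s * mom ω R k s +
      ω ^ 2 * switching ω k s * rad ω R k s - switching ω k s *
      (R * (k * Real.cos (ω * s) - ω ^ 2 * (Real.sin (ω * s) / ω)) ^ 2 +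
        Real.cos (ω * s) ^ 2 / R) := by
    unfold rad switchingDeriv switching mom
    generalize Real.sin (ω * s) / ω = S at *
    generalize Real.cos (ω * s) = C at *
    linear_combination k * (R * (C + k * S) ^ 2 + S ^ 2 / R) * h
  linear_combination rad ω R k s * this

variable {r ρ w v : ℝ → ℝ} {c l₀ s : ℝ}

theorem hasDerivAt_stateOf (hr : 0 < r s) (dr : HasDerivAt r (2 * ρ s) s)
    (dρ : HasDerivAt ρ ((1 + ρ s ^ 2) / r s - c * r s) s) :
    HasDerivAt (fun s => stateOf (r s) (ρ s)) (field c (stateOf (r s) (ρ s))) s := by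
  have d1 : HasDerivAt (fun s => √(r s)) (ρ s / √(r s)) s :=
    (dr.sqrt hr.ne').congr_deriv (by field_simp)
  have hq : 0 < √(r s) := Real.sqrt_pos.2 hr
  have d2 := dρ.fun_div d1 hq.ne'
  refine (d1.prodMk d2).congr_deriv ?_
  have hsq : r s = √(r s) ^ 2 := (Real.sq_sqrt hr.le).symm
  simp only [field, drift, ctrl, stateOf, Prod.mk_add_mk, Prod.smul_mk, smul_eq_mul, mul_zero,
    add_zero, Prod.mk.injEq, true_and]
  rw [hsq, Real.sqrt_sq hq.le]
  generalize √(r s) = q at *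
  field_simp
  ring

theorem hamiltonian_costateOf (hr : 0 < r s)
    (hH : l₀ * r s ^ 2 = v s * ρ s * r s + c * w s * r s ^ 2 - w s * (1 + ρ s ^ 2)) :
    hamiltonian l₀ (costateOf (r s) (ρ s) (w s) (v s)) (stateOf (r s) (ρ s)) c = 0 := by
  have hq : 0 < √(r s) := Real.sqrt_pos.2 hr
  have hsq : r s = √(r s) ^ 2 := (Real.sq_sqrt hr.le).symm
  rw [hamiltonian_eq]
  simp only [stateOf, costateOf]
  rw [hsq] at hH ⊢
  rw [Real.sqrt_sq hq.le]
  generalize √(r s) = q at *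
  field_simp
  linear_combination hH

theorem hasDerivAt_costateOf (hr : 0 < r s) (dr : HasDerivAt r (2 * ρ s) s)
    (dρ : HasDerivAt ρ ((1 + ρ s ^ 2) / r s - c * r s) s) (dw : HasDerivAt w (v s) s)
    (dv : HasDerivAt v (2 * l₀ - 4 * c * w s) s)
    (hH : l₀ * r s ^ 2 = v s * ρ s * r s + c * w s * r s ^ 2 - w s * (1 + ρ s ^ 2)) :
    HasDerivAt (fun s => costateOf (r s) (ρ s) (w s) (v s))
      (adjointRHS l₀ (costateOf (r s) (ρ s) (w s) (v s)) (stateOf (r s) (ρ s)) c) s := by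
  have d1 : HasDerivAt (fun s => √(r s)) (ρ s / √(r s)) s :=
    (dr.sqrt hr.ne').congr_deriv (by field_simp)
  have hq : 0 < √(r s) := Real.sqrt_pos.2 hr
  have d2 := (((dw.fun_mul dρ).fun_div dr hr.ne').fun_sub dv).fun_div d1 hq.ne'
  have d3 := dw.fun_div d1 hq.ne'
  refine (d2.prodMk d3).congr_deriv ?_
  have hsq : r s = √(r s) ^ 2 := (Real.sq_sqrt hr.le).symm
  rw [adjointRHS_eq _ _ _ _ (by simpa [stateOf] using hr)]
  simp only [stateOf, costateOf]
  rw [hsq] at hH ⊢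
  rw [Real.sqrt_sq hq.le]
  generalize √(r s) = q at *
  refine Prod.ext ?_ ?_
  · simp only
    field_simp
    linear_combination (-2) * hH
  · simp only
    field_simp
    ring

end CanonicalArc

/-- The trajectory of the constant control `ω²` passing at time `τ` through the point with
`x₁² = R` and `x₂ = k x₁`. -/
def arcState (ω R k τ t : ℝ) : ℝ × ℝ := stateOf (rad ω R k (t - τ)) (mom ω R k (t - τ))

/-- The multiplier along `arcState` with `l₂ = 0` at time `τ`. -/
def arcCostate (ω R k τ t : ℝ) : ℝ × ℝ :=
  costateOf (rad ω R k (t - τ)) (mom ω R k (t - τ)) (switching ω k (t - τ))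
    (switchingDeriv ω k (t - τ))

section Arc

variable {ω R k u₁ u₂ a b τ : ℝ}

theorem hamiltonian_arc (hω : ω ≠ 0) (hR : 0 < R) (t : ℝ) :
    hamiltonian (-k) (arcCostate ω R k τ t) (arcState ω R k τ t) (ω ^ 2) = 0 :=
  hamiltonian_costateOf (s := t - τ) (r := rad ω R k) (ρ := mom ω R k) (w := switching ω k)
    (v := switchingDeriv ω k) (rad_pos hω hR _) (switching_relation hω hR _)

theorem arcCostate_ne_zero (hω : ω ≠ 0) (hR : 0 < R) (hk : k ≠ 0) (t : ℝ) :
    arcCostate ω R k τ t ≠ 0 := by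
  intro h
  have := hamiltonian_arc (k := k) (τ := τ) hω hR t
  rw [h, hamiltonian_eq] at this
  simp at this
  exact hk this

theorem hasDerivAt_arcState (hω : ω ≠ 0) (hR : 0 < R) (t : ℝ) :
    HasDerivAt (arcState ω R k τ) (field (ω ^ 2) (arcState ω R k τ t)) t :=
  HasDerivAt.comp_sub_const t τ (hasDerivAt_stateOf (s := t - τ) (r := rad ω R k)
    (ρ := mom ω R k) (rad_pos hω hR _) (hasDerivAt_rad hω _) (hasDerivAt_mom hω hR _))

theorem hasDerivAt_arcCostate (hω : ω ≠ 0) (hR : 0 < R) (t : ℝ) :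
    HasDerivAt (arcCostate ω R k τ)
      (adjointRHS (-k) (arcCostate ω R k τ t) (arcState ω R k τ t) (ω ^ 2)) t :=
  HasDerivAt.comp_sub_const t τ (hasDerivAt_costateOf (s := t - τ) (r := rad ω R k)
    (ρ := mom ω R k) (w := switching ω k) (v := switchingDeriv ω k) (rad_pos hω hR _)
    (hasDerivAt_rad hω _) (hasDerivAt_mom hω hR _) (hasDerivAt_switching hω _)
    ((hasDerivAt_switchingDeriv hω _).congr_deriv (by ring)) (switching_relation hω hR _))

theorem isPiece_arc (hω : ω ≠ 0) (hR : 0 < R) (hk : k ≠ 0) (hu : u₁ ≤ u₂)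
    (h : (ω ^ 2 = u₁ ∧ ∀ t ∈ Icc a b, 0 ≤ switching ω k (t - τ)) ∨
      (ω ^ 2 = u₂ ∧ ∀ t ∈ Icc a b, switching ω k (t - τ) ≤ 0)) :
    IsPiece u₁ u₂ (-k) a b (arcState ω R k τ) (fun _ => ω ^ 2) (arcCostate ω R k τ) := by
  have hr : ∀ t, rad ω R k (t - τ) ≠ 0 := fun t => (rad_pos hω hR _).ne'
  have hq : ∀ t, √(rad ω R k (t - τ)) ≠ 0 := fun t => (Real.sqrt_pos.2 (rad_pos hω hR _)).ne'
  have e1 : ContDiff ℝ 1 fun t => rad ω R k (t - τ) := by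
    unfold rad
    fun_prop
  have e2 : ContDiff ℝ 1 fun t => mom ω R k (t - τ) := by
    unfold mom
    fun_prop
  have e3 : ContDiff ℝ 1 fun t => switching ω k (t - τ) := by
    unfold switching
    fun_prop
  have e4 : ContDiff ℝ 1 fun t => switchingDeriv ω k (t - τ) := by
    unfold switchingDeriv
    fun_prop
  have e5 : ContDiff ℝ 1 fun t => √(rad ω R k (t - τ)) := e1.sqrt hr
  refine ⟨measurable_const, fun _ => ?_, fun t => Real.sqrt_pos.2 (rad_pos hω hR _),
    arcCostate_ne_zero hω hR hk, e5.locallyLipschitz, (e2.div e5 hq).locallyLipschitz,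
    ((((e3.mul e2).div e1 hr).sub e4).div e5 hq).locallyLipschitz,
    (e3.div e5 hq).locallyLipschitz, ∅, finite_empty, fun t ht _ => ?_⟩
  · rcases h with ⟨h, -⟩ | ⟨h, -⟩ <;> rw [h]
    · exact left_mem_Icc.2 hu
    · exact right_mem_Icc.2 hu
  · refine ⟨hasDerivAt_arcState hω hR t, hasDerivAt_arcCostate hω hR t, fun v hv => ?_,
      hamiltonian_arc hω hR t⟩
    have hsw : (arcCostate ω R k τ t).2 * (arcState ω R k τ t).1 = switching ω k (t - τ) :=
      div_mul_cancel₀ _ (hq t)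
    have : hamiltonian (-k) (arcCostate ω R k τ t) (arcState ω R k τ t) (ω ^ 2) -
        hamiltonian (-k) (arcCostate ω R k τ t) (arcState ω R k τ t) v =
        (v - ω ^ 2) * switching ω k (t - τ) := by
      rw [hamiltonian_eq, hamiltonian_eq, ← hsw]
      ring
    rw [← sub_nonneg, this]
    rcases h with ⟨h, hs⟩ | ⟨h, hs⟩ <;> rw [h]
    · exact mul_nonneg (sub_nonneg.2 hv.1) (hs t ht)
    · exact mul_nonneg_of_nonpos_of_nonpos (sub_nonpos.2 hv.2) (hs t ht)

theorem arcState_self (ω R k τ : ℝ) : arcState ω R k τ τ = stateOf R (R * k) := by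
  simp [arcState, rad, mom]

theorem arcCostate_self (ω R k τ : ℝ) : arcCostate ω R k τ τ = costateOf R (R * k) 0 (-1) := by
  simp [arcCostate, rad, mom, switching, switchingDeriv]

end Arc

/-! ### An extremal with three switchings. -/

/-- On a `Y`-arc (`ω = 1`) `l₂ ≤ 0` up to the next switching. -/
theorem switching_nonpos {k s : ℝ} (h0 : 0 ≤ s) (h1 : s ≤ Real.pi / 2 + Real.arctan k) :
    switching 1 k s ≤ 0 := by
  have hA := Real.arctan_lt_pi_div_two k
  have hA' := Real.neg_pi_div_two_lt_arctan k
  have hc : 0 < Real.cos (Real.arctan k) := Real.cos_arctan_pos k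
  have hk : k * Real.cos (Real.arctan k) = Real.sin (Real.arctan k) := by
    nth_rewrite 1 [← Real.tan_arctan k]
    rw [Real.tan_mul_cos hc.ne']
  have hS : 0 ≤ Real.sin s := Real.sin_nonneg_of_nonneg_of_le_pi h0 (by linarith)
  -- The second factor of `switching` is a positive multiple of a cosine shifted by `arctan k`,
  -- first vanishing after time `0` at `π / 2 + arctan k`.
  have h2 : Real.cos (Real.arctan k) * (Real.cos s + k * Real.sin s) =
      Real.cos (s - Real.arctan k) := by
    rw [Real.cos_sub]
    linear_combination Real.sin s * hk
  have h3 : 0 ≤ Real.cos (s - Real.arctan k) :=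
    Real.cos_nonneg_of_neg_pi_div_two_le_of_le (by linarith) (by linarith)
  have h4 : 0 ≤ Real.cos s + k * Real.sin s := by
    rw [← h2] at h3
    exact nonneg_of_mul_nonneg_right h3 hc
  unfold switching
  simp only [one_mul, div_one]
  have := mul_nonneg hS h4
  linarith

/-- On an `X`-arc `l₂ ≥ 0` back to the previous switching. -/
theorem switching_nonneg {ω k s θ : ℝ} (hω : 0 < ω) (hθ : 0 < θ) (hθπ : θ < Real.pi)
    (hk : k * Real.sin θ = ω * Real.cos θ) (h0 : s ≤ 0) (h1 : -θ ≤ ω * s) :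
    0 ≤ switching ω k s := by
  have hωs : ω * s ≤ 0 := mul_nonpos_of_nonneg_of_nonpos hω.le h0
  have hS : Real.sin (ω * s) / ω ≤ 0 :=
    div_nonpos_of_nonpos_of_nonneg (Real.sin_nonpos_of_nonpos_of_neg_pi_le hωs (by linarith)) hω.le
  have hsin : 0 < Real.sin θ := Real.sin_pos_of_pos_of_lt_pi hθ hθπ
  have h2 : Real.sin θ * (Real.cos (ω * s) + k * (Real.sin (ω * s) / ω)) =
      Real.sin (θ + ω * s) := by
    rw [Real.sin_add]
    field_simp
    linear_combination Real.sin (ω * s) * hk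
  have h3 : 0 ≤ Real.sin (θ + ω * s) :=
    Real.sin_nonneg_of_nonneg_of_le_pi (by linarith) (by linarith)
  have h4 : 0 ≤ Real.cos (ω * s) + k * (Real.sin (ω * s) / ω) := by
    rw [← h2] at h3
    exact nonneg_of_mul_nonneg_right h3 hsin
  have := mul_nonneg_of_nonpos_of_nonpos hS (neg_nonpos.2 h4)
  unfold switching
  linarith

/-- On a `Y`-arc with positive initial slope the abscissa has a critical point within a quarter of
a turn, with bounds on its value. -/
theorem exists_mom_eq_zero {R k : ℝ} (hR : 0 < R) (hk : 0 < k) (hk1 : k ≤ 1) :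
    ∃ s, 0 < s ∧ s < Real.pi / 2 ∧ mom 1 R k s = 0 ∧ R * k ^ 2 ≤ rad 1 R k s ∧
      rad 1 R k s ≤ R * (1 + k ^ 2) + 1 / R := by
  have hcont : Continuous (mom 1 R k) := by
    unfold mom
    fun_prop
  have hpi := Real.pi_pos
  obtain ⟨s, hs, hs0⟩ : (0 : ℝ) ∈ mom 1 R k '' Ioo 0 (Real.pi / 2) := by
    refine intermediate_value_Ioo' (by linarith) hcont.continuousOn ⟨?_, ?_⟩
    · simp [mom]
      positivity
    · simp [mom]
      positivity
  have hC := Real.cos_pos_of_mem_Ioo (x := s) ⟨by linarith [hs.1], hs.2⟩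
  have hS := Real.sin_pos_of_pos_of_lt_pi hs.1 (by linarith [hs.2])
  have h1 := Real.cos_sq_add_sin_sq s
  refine ⟨s, hs.1, hs.2, hs0, ?_, ?_⟩
  · unfold rad
    simp only [one_mul, div_one]
    have h2 : k ^ 2 ≤ (Real.cos s + k * Real.sin s) ^ 2 := by
      have : k ^ 2 ≤ 1 := pow_le_one₀ hk.le hk1
      nlinarith [mul_pos (mul_pos hk hS) hC, sq_nonneg (Real.cos s)]
    have h3 := mul_le_mul_of_nonneg_left h2 hR.le
    have : 0 ≤ Real.sin s ^ 2 / R := by positivity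
    linarith
  · unfold rad
    simp only [one_mul, div_one]
    have h2 : (Real.cos s + k * Real.sin s) ^ 2 ≤ 1 + k ^ 2 := by
      nlinarith [sq_nonneg (k * Real.cos s - Real.sin s)]
    have h3 := mul_le_mul_of_nonneg_left h2 hR.le
    have h4 : Real.sin s ^ 2 / R ≤ 1 / R := by
      gcongr
      nlinarith [sq_nonneg (Real.cos s)]
    linarith

/-- At a switching `H = 0` gives `l₀ = -(l₁ x₁)(x₂ / x₁)`, and `l₁ x₁` changes sign from one
switching to the next, so the slopes `x₂ / x₁` are `k, -k, k`. With `l₁ x₁ = 1` at the first and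
third switching, `l₀ = -k`. The last `Y`-arc is stopped when `x₂ = 0`, which defines `γ`. -/
theorem exists_extremal_three_switchings : ∃ γ u₁ u₂ : ℝ, Bounds γ u₁ u₂ ∧ u₂ = 1 ∧
    ∃ (T : ℝ) (x : ℝ → ℝ × ℝ) (u : ℝ → ℝ), IsExtremal γ u₁ u₂ T x u ∧
      ∃ n : ℕ, 1 ≤ n ∧ IsAlternatingFromX u₁ u₂ T u (2 * n + 1) := by
  -- Taking `tan φ = ω` for the first arc, run from `(1, 0)` during `φ / ω = 20 φ`, gives `x₁² = 2
  -- cos² φ = R₁` and slope `k = (1 - ω²) / 2` at its end.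
  set φ := Real.arctan (1 / 20) with hφ
  have hφ0 : 0 < φ := Real.arctan_pos.2 (by norm_num)
  have hφπ : φ < Real.pi / 2 := Real.arctan_lt_pi_div_two _
  have hc : 0 < Real.cos φ := Real.cos_arctan_pos _
  have hc2 : Real.cos φ ^ 2 = 400 / 401 := by
    rw [hφ, Real.cos_sq_arctan]
    norm_num
  have hs : Real.sin φ = Real.cos φ / 20 := by
    rw [← Real.tan_mul_cos hc.ne', hφ, Real.tan_arctan]
    ring
  have hcos2 : Real.cos (2 * φ) = 399 / 401 := by
    rw [Real.cos_two_mul, hc2]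
    norm_num
  have hsin2 : Real.sin (2 * φ) = 40 / 401 := by
    rw [Real.sin_two_mul, hs]
    linear_combination hc2 / 10
  set ω : ℝ := 1 / 20 with hω
  set k : ℝ := 399 / 800 with hk
  set R₁ : ℝ := 800 / 401 with hR₁
  -- `R₃` solves `1 / ((1 + k²) R₁) = sin² (2φ) / (ω² R₃)`, the equality of `x₁²` on both sides of
  -- the second switching.
  set R₃ : ℝ := 8 * (k ^ 2 + 1) / (401 / 400) ^ 3 with hR₃
  have hω0 : ω ≠ 0 := by norm_num [hω]
  have hk0 : k ≠ 0 := by norm_num [hk]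
  have hR₁0 : 0 < R₁ := by norm_num [hR₁]
  have hR₃0 : 0 < R₃ := by norm_num [hR₃, hk]
  obtain ⟨s, hs0, hsπ, hmom, hlow, hupp⟩ := exists_mom_eq_zero hR₃0
    (by norm_num [hk] : 0 < k) (by norm_num [hk])
  -- The lower bound yields `γ > 1`; the upper bound `γ² ≤ 20` yields `u₁ = 1 / 400 ≤ 1 / γ⁴`.
  have hrlow : 1 < rad 1 R₃ k s := lt_of_lt_of_le (by norm_num [hR₃, hk]) hlow
  have hrupp : rad 1 R₃ k s ≤ 20 := hupp.trans (by norm_num [hR₃, hk])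
  -- `Δ` is the full time between switchings on a `Y`-arc of initial slope `k`. Since `s < π / 2 <
  -- Δ`, the last arc ends before another switching.
  set Δ := Real.pi / 2 + Real.arctan k with hΔ
  have hΔπ : Real.pi / 2 < Δ := by
    have := Real.arctan_pos.2 (by norm_num [hk] : 0 < k)
    linarith
  set τ₁ := 20 * φ with hτ₁
  set τ₂ := τ₁ + Δ with hτ₂
  set τ₃ := τ₂ + 40 * φ with hτ₃
  have hpi := Real.pi_pos
  -- Since `tan (2φ) = 2ω / (1 - ω²) = ω / k`, the `X`-arc between switchings lasts `2φ / ω = 40 φ`,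
  -- twice the first one.
  have hkθ : k * Real.sin (2 * φ) = ω * Real.cos (2 * φ) := by
    rw [hsin2, hcos2]
    norm_num [hk, hω]
  -- the switching at the end of the first `Y`-arc
  have hmid : rad 1 R₁ k Δ = rad ω R₃ k (-(40 * φ)) ∧ mom 1 R₁ k Δ = mom ω R₃ k (-(40 * φ)) ∧
      switching 1 k Δ = switching ω k (-(40 * φ)) ∧
      switchingDeriv 1 k Δ = switchingDeriv ω k (-(40 * φ)) := by
    have a1 : ω * -(40 * φ) = -(2 * φ) := by rw [hω]; ring
    set q := √(1 + k ^ 2) with hq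
    have hq0 : 0 < q := Real.sqrt_pos.2 (by positivity)
    have hq2 : q ^ 2 = 1 + k ^ 2 := Real.sq_sqrt (by positivity)
    have b1 : Real.cos Δ = -k / q := by
      rw [hΔ, add_comm, Real.cos_add_pi_div_two, Real.sin_arctan, neg_div]
    have b2 : Real.sin Δ = 1 / q := by
      rw [hΔ, add_comm, Real.sin_add_pi_div_two, Real.cos_arctan]
    have b3 : (1 / q) ^ 2 = 1 / (1 + k ^ 2) := by rw [div_pow, hq2, one_pow]
    have z1 : Real.cos Δ + k * Real.sin Δ = 0 := by rw [b1, b2]; ring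
    have z2 : Real.sin Δ ^ 2 = 1 / (1 + k ^ 2) := by rw [b2, b3]
    have z3 : Real.cos Δ = -k * Real.sin Δ := by linarith
    refine ⟨?_, ?_, ?_, ?_⟩
    · unfold rad
      rw [a1, Real.cos_neg, Real.sin_neg, hcos2, hsin2, one_mul, div_one, z1, z2]
      norm_num [hω, hk, hR₁, hR₃]
    · unfold mom
      rw [a1, Real.cos_neg, Real.sin_neg, hcos2, hsin2, one_mul, div_one, z1, z3]
      have : Real.sin Δ * (-k * Real.sin Δ) = -k * (1 / (1 + k ^ 2)) := by rw [← z2]; ring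
      rw [this]
      norm_num [hω, hk, hR₁, hR₃]
    · unfold switching
      rw [a1, Real.cos_neg, Real.sin_neg, hcos2, hsin2, one_mul, div_one, z1]
      norm_num [hω, hk]
    · unfold switchingDeriv
      rw [a1, Real.cos_neg, Real.sin_neg, hcos2, hsin2, one_mul, div_one, z1, z3]
      have : Real.sin Δ * (k * (-k * Real.sin Δ) - 1 ^ 2 * Real.sin Δ) = -1 := by
        have h0 : 1 + k ^ 2 ≠ 0 := by positivity
        have h1 : (1 + k ^ 2) * Real.sin Δ ^ 2 = 1 := by rw [z2]; field_simp
        linear_combination -h1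
      rw [this]
      norm_num [hω, hk]
  obtain ⟨m1, m2, m3, m4⟩ := hmid
  have hu : ω ^ 2 ≤ (1 : ℝ) ^ 2 := by norm_num [hω]
  have hX : ∀ r, -(40 * φ) ≤ r → r ≤ 0 → 0 ≤ switching ω k r := fun r h1 h2 =>
    switching_nonneg (θ := 2 * φ) (by norm_num [hω]) (by linarith) (by linarith) hkθ h2
      (by rw [hω]; linarith)
  have piece : IsPiece (ω ^ 2) (1 ^ 2) (-k) 0 (τ₃ + s) _ _ _ :=
    (isPiece_arc (a := 0) (b := τ₁) (τ := τ₁) hω0 hR₁0 hk0 hu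
      (Or.inl ⟨rfl, fun t ht => hX _ (by linarith [ht.1]) (by linarith [ht.2])⟩)).glue
    ((isPiece_arc (a := τ₁) (b := τ₂) (τ := τ₁) one_ne_zero hR₁0 hk0 hu
      (Or.inr ⟨rfl, fun t ht => switching_nonpos (by linarith [ht.1]) (by linarith [ht.2])⟩)).glue
    ((isPiece_arc (a := τ₂) (b := τ₃) (τ := τ₃) hω0 hR₃0 hk0 hu
      (Or.inl ⟨rfl, fun t ht => hX _ (by linarith [ht.1]) (by linarith [ht.2])⟩)).glue
    (isPiece_arc (a := τ₃) (b := τ₃ + s) (τ := τ₃) one_ne_zero hR₃0 hk0 hu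
      (Or.inr ⟨rfl, fun t ht => switching_nonpos (by linarith [ht.1]) (by linarith [ht.2])⟩))
      (by rw [arcState_self, arcState_self]) (by rw [arcCostate_self, arcCostate_self]))
      (by
        rw [glue_of_lt (by linarith)]
        simp only [arcState]
        rw [show τ₂ - τ₁ = Δ by linarith, show τ₂ - τ₃ = -(40 * φ) by linarith, m1, m2])
      (by
        rw [glue_of_lt (by linarith)]
        simp only [arcCostate]
        rw [show τ₂ - τ₁ = Δ by linarith, show τ₂ - τ₃ = -(40 * φ) by linarith, m1, m2, m3, m4]))
      (by rw [glue_of_lt (by linarith), arcState_self, arcState_self])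
      (by rw [glue_of_lt (by linarith), arcCostate_self, arcCostate_self])
  rw [one_pow] at piece
  have hγ : 1 < √(rad 1 R₃ k s) := by rw [Real.lt_sqrt zero_le_one]; simpa using hrlow
  have hγ4 : √(rad 1 R₃ k s) ^ 4 = rad 1 R₃ k s ^ 2 := by
    rw [show 4 = 2 * 2 from rfl, pow_mul, Real.sq_sqrt (by linarith)]
  refine ⟨√(rad 1 R₃ k s), ω ^ 2, 1, ⟨hγ, by positivity, ?_, ?_, le_rfl⟩, rfl, τ₃ + s, _, _,
    piece.isExtremal (by linarith) (by norm_num [hk]) ?_ ?_, 1, le_rfl,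
    fun j => if j = 0 then 0 else if j = 1 then τ₁ else if j = 2 then τ₂ else
      if j = 3 then τ₃ else τ₃ + s, by simp, by simp, ?_, ?_⟩
  · rw [hγ4, le_div_iff₀ (by positivity), ← mul_pow]
    exact pow_le_one₀ (by positivity) (by rw [hω]; linarith)
  · rw [hγ4, div_lt_one (by positivity)]
    exact one_lt_pow₀ hrlow two_ne_zero
  · rw [glue_of_lt (by linarith)]
    have a1 : ω * (0 - τ₁) = -φ := by rw [hω, hτ₁]; ring
    have r1 : rad ω R₁ k (0 - τ₁) = 1 := by
      unfold rad
      rw [a1, Real.cos_neg, Real.sin_neg, hs, hω, hk, hR₁]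
      ring_nf
      rw [hc2]
      norm_num
    have r2 : mom ω R₁ k (0 - τ₁) = 0 := by
      unfold mom
      rw [a1, Real.cos_neg, Real.sin_neg, hs, hω, hk, hR₁]
      ring
    simp only [arcState, stateOf, r1, r2, Real.sqrt_one, div_one]
  · rw [glue_of_ge (by linarith), glue_of_ge (by linarith), glue_of_ge (by linarith)]
    simp [arcState, stateOf, hmom]
  · intro j hj
    interval_cases j <;> norm_num <;> linarith
  · intro j hj
    refine (ae_restrict_iff' measurableSet_Ioo).2 (Filter.Eventually.of_forall fun t ht => ?_)
    interval_cases j <;> norm_num at ht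
    · rw [glue_of_lt ht.2, if_pos (by decide)]
    · rw [glue_of_ge ht.1.le, glue_of_lt ht.2, if_neg (by decide)]
    · rw [glue_of_ge (by linarith), glue_of_ge ht.1.le, glue_of_lt ht.2, if_pos (by decide)]
    · rw [glue_of_ge (by linarith), glue_of_ge (by linarith), glue_of_ge ht.1.le,
        if_neg (by decide)]

end Oscillator

end

theorem mainTheorem4 :
    (∀ γ u₁ u₂ : ℝ, Oscillator.Bounds γ u₁ u₂ → u₂ = 1 →
      Oscillator.field u₂ (1, 0) = 0 ∧
      ∀ (T : ℝ) (x : ℝ → ℝ × ℝ) (u : ℝ → ℝ), Oscillator.IsExtremal γ u₁ u₂ T x u →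
        ¬ Oscillator.BeginsWith u₂ T u ∧
        ∃ n : ℕ, Oscillator.IsAlternatingFromX u₁ u₂ T u (2 * n + 1)) ∧
    ∃ (γ u₁ u₂ : ℝ), Oscillator.Bounds γ u₁ u₂ ∧ u₂ = 1 ∧
      ∃ (T : ℝ) (x : ℝ → ℝ × ℝ) (u : ℝ → ℝ), Oscillator.IsExtremal γ u₁ u₂ T x u ∧
        ∃ n : ℕ, 1 ≤ n ∧ Oscillator.IsAlternatingFromX u₁ u₂ T u (2 * n + 1) := by
  refine ⟨?_, Oscillator.exists_extremal_three_switchings⟩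
  rintro γ u₁ u₂ hB rfl
  refine ⟨by simp [Oscillator.field, Oscillator.drift, Oscillator.ctrl], fun T x u hE => ?_⟩
  obtain ⟨n, hn⟩ := hE.exists_isAlternatingFromX hB
  exact ⟨hn.not_beginsWith (hB.le_target.trans_lt hB.target_lt).ne, n, hn⟩
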